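/- Let $\Bbbk$ be an algebraically closed field and let $\mathcal{C}$ be a modular category over $\Bbbk$, i.e. a (not necessarily semisimple) ribbon category, with left duality morphisms $\mathrm{ev}_X : X^* \otimes X \to \mathbf{1}$ and $\mathrm{coev}_X : \mathbf{1} \to X \otimes X^*$, braiding $c$ and twist $\theta$, which is equivalent as a $\Bbbk$-linear category to the category of finite-dimensional modules over a finite-dimensional $\Bbbk$-algebra, has bilinear tensor product and simple tensor unit $\mathbf{1}$, and is factorizable: on the coend $\mathcal{A} = \int^{X \in \mathcal{C}} X^* \otimes X$, with dinatural family $i_X : X^* \otimes X \to \mathcal{A}$, the Hopf pairing $\omega : \mathcal{A} \otimes \mathcal{A} \to \mathbf{1}$ determined (up to coherence isomorphisms) by $$\omega \circ (i_X \otimes i_Y) = (\mathrm{ev}_X \otimes \mathrm{ev}_Y) \circ (\mathrm{id}_{X^*} \otimes (c_{Y^*,X} \circ c_{X,Y^*}) \otimes \mathrm{id}_Y)$$ is non-degenerate, i.e. $(\omega \otimes \mathrm{id}_{\mathcal{A}^*}) \circ (\mathrm{id}_{\mathcal{A}} \otimes \mathrm{coev}_{\mathcal{A}}) : \mathcal{A}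 \to \mathcal{A}^*$ is an isomorphism. The coend $\mathcal{A}$ carries the product $\mu$ with $\mu \circ (i_X \otimes i_Y) = i_{X \otimes Y} \circ (c_{X^* \otimes X, Y^*} \otimes \mathrm{id}_Y)$ (where $Y^* \otimes X^* \cong (X \otimes Y)^*$), the unit $\eta : \mathbf{1} \cong \mathbf{1}^* \otimes \mathbf{1} \to \mathcal{A}$ given by $i_{\mathbf{1}}$, the coproduct $\Delta$ with $\Delta \circ i_X = (i_X \otimes i_X) \circ (\mathrm{id}_{X^*} \otimes \mathrm{coev}_X \otimes \mathrm{id}_X)$, the counit $\epsilon$ with $\epsilon \circ i_X = \mathrm{ev}_X$, and the automorphism $\mathcal{T}$ with $\mathcal{T} \circ i_X = i_X \circ (\mathrm{id}_{X^*} \otimes \theta_X)$. Let $\Lambda : \mathbf{1} \to \mathcal{A}$ be a non-zero integral, i.e. $\mu \circ (\Lambda \otimes \mathrm{id}_{\mathcal{A}}) = \Lambda \circ \epsilon$. Then there are scalars $\Delta_+, \Delta_- \in \Bbbk$, the stabilization coefficients of $\Lambda$, with $$\epsilon \circ \mathcal{T}^{\pm 1} \circ \Lambda = \Delta_{\pm}\,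 \mathrm{id}_{\mathbf{1}},$$ and a scalar $\zeta \in \Bbbk^*$, the modularity parameter of $\Lambda$, with $$\omega \circ (\Lambda \otimes \mathrm{id}_{\mathcal{A}}) = \zeta\, \Lambda^{\mathrm{co}}$$ for a two-sided cointegral $\Lambda^{\mathrm{co}} : \mathcal{A} \to \mathbf{1}$, i.e. $(\Lambda^{\mathrm{co}} \otimes \mathrm{id}_{\mathcal{A}}) \circ \Delta = \eta \circ \Lambda^{\mathrm{co}} = (\mathrm{id}_{\mathcal{A}} \otimes \Lambda^{\mathrm{co}}) \circ \Delta$, satisfying $\Lambda^{\mathrm{co}} \circ \Lambda = \mathrm{id}_{\mathbf{1}}$. For any such scalars, $$\Delta_- \Delta_+ = \zeta .$$ In particular $\mathcal{C}$ is twist non-degenerate: for every non-zero integral $\Lambda$, the coefficients $\Delta_+$ and $\Delta_-$ are both non-zero. -/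

import Mathlib

open CategoryTheory MonoidalCategory Limits Opposite

set_option linter.unusedSectionVars false

/-- A ribbon category: a braided rigid monoidal category with a twist, i.e. a natural
automorphism `θ` of the identity functor such that
`θ_{X ⊗ Y} = c_{Y,X} ∘ c_{X,Y} ∘ (θ_X ⊗ θ_Y)` and `θ_{X*} = (θ_X)*`.
The dual `X*` of `X` is Mathlib's `Xᘁ`, with `ev : X* ⊗ X ⟶ 𝟙` and `coev : 𝟙 ⟶ X ⊗ X*`;
thanks to the braiding and the twist it is a two-sided dual. -/
class RibbonCategory (C : Type*) [Category C] [MonoidalCategory C] [BraidedCategory C]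
    [RightRigidCategory C] where
  /-- The twist. -/
  twist : 𝟭 C ≅ 𝟭 C
  twist_tensor (X Y : C) : twist.hom.app (X ⊗ Y) =
    (twist.hom.app X ⊗ₘ twist.hom.app Y) ≫ (β_ X Y).hom ≫ (β_ Y X).hom
  twist_dual (X : C) : twist.hom.app (Xᘁ) = (twist.hom.app X)ᘁ

namespace RibbonCategory

section Coend

variable {C : Type*} [Category C] [MonoidalCategory C] [RightRigidCategory C]

/-! ### The coend `∫^X X* ⊗ X` -/

variable (C) in
/-- The functor `Cᵒᵖ × C ⥤ C` sending `(X, Y)` to `X* ⊗ Y`. -/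
@[simps]
def dualTensor : Cᵒᵖ ⥤ C ⥤ C where
  obj X := tensorLeft ((unop X)ᘁ)
  map f := { app := fun Y => (f.unop)ᘁ ▷ Y
             naturality := fun _ _ g => whisker_exchange _ g }
  map_id X := by
    ext Y
    simp
  map_comp f g := by
    ext Y
    simp [comp_rightAdjointMate]

/-- A cowedge `c` (an object `c.pt` with a dinatural family `X* ⊗ X ⟶ c.pt`) is a coend of
`(X, Y) ↦ X* ⊗ Y` if it is universal. -/
abbrev IsCoend (c : Cowedge (dualTensor C)) := IsColimit c

/-- The component `i_X : X* ⊗ X ⟶ c.pt` of the dinatural transformation of a cowedge. -/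
def incl (c : Cowedge (dualTensor C)) (X : C) : Xᘁ ⊗ X ⟶ c.pt := c.π X

/-- A family `X* ⊗ X ⟶ Z` is dinatural. -/
def Dinatural {Z : C} (φ : ∀ X : C, Xᘁ ⊗ X ⟶ Z) : Prop :=
  ∀ ⦃X Y : C⦄ (f : X ⟶ Y), fᘁ ▷ X ≫ φ X = Yᘁ ◁ f ≫ φ Y

theorem incl_dinatural (c : Cowedge (dualTensor C)) : Dinatural (incl c) :=
  fun _ _ f => c.condition f

/-- The morphism out of the coend induced by a dinatural family. -/
def descCoend {c : Cowedge (dualTensor C)} (hc : IsCoend c) {Z : C} (φ : ∀ X : C, Xᘁ ⊗ X ⟶ Z) (hφ : Dinatural φ) : c.pt ⟶ Z :=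
  Cowedge.IsColimit.desc hc φ hφ

@[simp]
theorem incl_descCoend {c : Cowedge (dualTensor C)} (hc : IsCoend c) {Z : C} (φ : ∀ X : C, Xᘁ ⊗ X ⟶ Z) (hφ : Dinatural φ) (X : C) :
    incl c X ≫ descCoend hc φ hφ = φ X :=
  Cowedge.IsColimit.π_desc hc φ hφ X

theorem coend_hom_ext {c : Cowedge (dualTensor C)} (hc : IsCoend c) {Z : C} {f g : c.pt ⟶ Z} (h : ∀ X, incl c X ≫ f = incl c X ≫ g) : f = g :=
  Cowedge.IsColimit.hom_ext hc h

theorem tensor_coend_hom_ext {c : Cowedge (dualTensor C)} (hc : IsCoend c) {W Z : C} {f g : c.pt ⊗ W ⟶ Z}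
    (h : ∀ X, incl c X ▷ W ≫ f = incl c X ▷ W ≫ g) : f = g := by
  apply (tensorRightHomEquiv c.pt W (Wᘁ) Z).injective
  apply coend_hom_ext hc
  intro X
  apply (tensorRightHomEquiv _ W (Wᘁ) Z).symm.injective
  simpa only [tensorRightHomEquiv_symm_naturality, Equiv.symm_apply_apply] using h X

theorem dinatural_curry {W Z : C} (φ : ∀ X : C, (Xᘁ ⊗ X) ⊗ W ⟶ Z)
    (hφ : ∀ ⦃X Y : C⦄ (f : X ⟶ Y), (fᘁ ▷ X) ▷ W ≫ φ X = (Yᘁ ◁ f) ▷ W ≫ φ Y) :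
    Dinatural (fun X : C => tensorRightHomEquiv ((Xᘁ : C) ⊗ X) W (Wᘁ) Z (φ X)) := by
  intro X Y f
  apply (tensorRightHomEquiv _ W (Wᘁ) Z).symm.injective
  simpa only [tensorRightHomEquiv_symm_naturality, Equiv.symm_apply_apply] using hφ f

/-- The extension of a family `(X* ⊗ X) ⊗ W ⟶ Z`, dinatural in `X`, to the coend. -/
def descTensor {c : Cowedge (dualTensor C)} (hc : IsCoend c) {W Z : C} (φ : ∀ X : C, (Xᘁ ⊗ X) ⊗ W ⟶ Z)
    (hφ : ∀ ⦃X Y : C⦄ (f : X ⟶ Y), (fᘁ ▷ X) ▷ W ≫ φ X = (Yᘁ ◁ f) ▷ W ≫ φ Y) :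
    c.pt ⊗ W ⟶ Z :=
  (tensorRightHomEquiv c.pt W (Wᘁ) Z).symm
    (descCoend hc (fun X : C => tensorRightHomEquiv ((Xᘁ : C) ⊗ X) W (Wᘁ) Z (φ X)) (dinatural_curry φ hφ))

theorem incl_descTensor {c : Cowedge (dualTensor C)} (hc : IsCoend c) {W Z : C} (φ : ∀ X : C, (Xᘁ ⊗ X) ⊗ W ⟶ Z)
    (hφ : ∀ ⦃X Y : C⦄ (f : X ⟶ Y), (fᘁ ▷ X) ▷ W ≫ φ X = (Yᘁ ◁ f) ▷ W ≫ φ Y) (X : C) :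
    incl c X ▷ W ≫ descTensor hc φ hφ = φ X := by
  rw [descTensor, ← tensorRightHomEquiv_symm_naturality, incl_descCoend, Equiv.symm_apply_apply]

theorem twist_dinatural (c : Cowedge (dualTensor C)) (t : 𝟭 C ⟶ 𝟭 C) :
    Dinatural (fun X : C => (Xᘁ : C) ◁ t.app X ≫ incl c X) := by
  intro X Y f
  have h : f ≫ t.app Y = t.app X ≫ f := t.naturality f
  dsimp only [Functor.id_obj] at h ⊢
  rw [← whisker_exchange_assoc, incl_dinatural c f, ← whiskerLeft_comp_assoc,
    ← whiskerLeft_comp_assoc, h]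

/-- A morphism into a dual object is determined by the associated pairing. -/
theorem dual_hom_ext {Z W : C} {a b : Z ⟶ Wᘁ}
    (h : a ▷ W ≫ ε_ W Wᘁ = b ▷ W ≫ ε_ W Wᘁ) : a = b := by
  have := congrArg (tensorRightHomEquiv Z W (Wᘁ) (𝟙_ C)) h
  rwa [tensorRightHomEquiv_whiskerRight_comp_evaluation,
    tensorRightHomEquiv_whiskerRight_comp_evaluation, cancel_mono] at this

/-- The canonical isomorphism `Y* ⊗ X* ≅ (X ⊗ Y)*` is compatible with evaluations. -/
theorem dualTensorIso_inv_evaluation (X Y : C) :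
    (rightDualTensorIso X Y).inv ▷ (X ⊗ Y) ≫ ε_ (X ⊗ Y) (X ⊗ Y)ᘁ =
      (α_ Yᘁ Xᘁ (X ⊗ Y)).hom ≫ Yᘁ ◁ ((α_ Xᘁ X Y).inv ≫ ε_ X Xᘁ ▷ Y ≫ (λ_ Y).hom) ≫
        ε_ Y Yᘁ := by
  have := @rightAdjointMate_comp_evaluation C _ _ (X ⊗ Y) (X ⊗ Y) inferInstance
    (hasRightDualTensor) (𝟙 _)
  rw [whiskerLeft_id, Category.id_comp] at this
  refine this.trans ?_
  refine (ExactPairing.tensor_evaluation (X₁ := X) (X₂ := Y) (Y₁ := Xᘁ) (Y₂ := Yᘁ)).trans ?_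
  monoidal

theorem dualTensorIso_inv_naturality_left {X X' : C} (f : X ⟶ X') (Y : C) :
    (Yᘁ : C) ◁ fᘁ ≫ (rightDualTensorIso X Y).inv =
      (rightDualTensorIso X' Y).inv ≫ (f ▷ Y)ᘁ := by
  apply dual_hom_ext
  rw [comp_whiskerRight, comp_whiskerRight, Category.assoc, Category.assoc,
    rightAdjointMate_comp_evaluation, ← whisker_exchange_assoc, dualTensorIso_inv_evaluation,
    dualTensorIso_inv_evaluation, associator_naturality_middle_assoc,
    associator_naturality_right_assoc, ← whiskerLeft_comp_assoc, ← whiskerLeft_comp_assoc,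
    associator_inv_naturality_left_assoc, associator_inv_naturality_middle_assoc,
    ← comp_whiskerRight_assoc, ← comp_whiskerRight_assoc, rightAdjointMate_comp_evaluation]

theorem dualTensorIso_inv_naturality_right (X : C) {Y Y' : C} (g : Y ⟶ Y') :
    gᘁ ▷ (Xᘁ : C) ≫ (rightDualTensorIso X Y).inv =
      (rightDualTensorIso X Y').inv ≫ (X ◁ g)ᘁ := by
  apply dual_hom_ext
  rw [comp_whiskerRight, comp_whiskerRight, Category.assoc, Category.assoc,
    rightAdjointMate_comp_evaluation, ← whisker_exchange_assoc, dualTensorIso_inv_evaluation,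
    dualTensorIso_inv_evaluation, associator_naturality_left_assoc,
    associator_naturality_right_assoc, ← whisker_exchange_assoc,
    rightAdjointMate_comp_evaluation, ← whiskerLeft_comp_assoc, ← whiskerLeft_comp_assoc]
  simp only [Category.assoc, associator_inv_naturality_right_assoc, whisker_exchange_assoc,
    leftUnitor_naturality]

/-- The morphism `id ⊗ coev_X ⊗ id : X* ⊗ X ⟶ (X* ⊗ X) ⊗ (X* ⊗ X)`. -/
def splitDual (X : C) : Xᘁ ⊗ X ⟶ (Xᘁ ⊗ X) ⊗ (Xᘁ ⊗ X) :=
  Xᘁ ◁ ((λ_ X).inv ≫ η_ X Xᘁ ▷ X ≫ (α_ X Xᘁ X).hom) ≫ (α_ Xᘁ X (Xᘁ ⊗ X)).inv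

theorem comul_dinatural (c : Cowedge (dualTensor C)) :
    Dinatural (fun X : C => splitDual X ≫ (incl c X ⊗ₘ incl c X)) := by
  intro X Y f
  have h : (λ_ X).inv ≫ η_ X Xᘁ ▷ X ≫ (α_ X Xᘁ X).hom ≫ f ▷ (Xᘁ ⊗ X) ≫ Y ◁ incl c X =
      f ≫ (λ_ Y).inv ≫ η_ Y Yᘁ ▷ Y ≫ (α_ Y Yᘁ Y).hom ≫ Y ◁ incl c Y := by
    rw [← associator_naturality_left_assoc, ← comp_whiskerRight_assoc,
      ← coevaluation_comp_rightAdjointMate, comp_whiskerRight_assoc,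
      associator_naturality_middle_assoc, ← whiskerLeft_comp, incl_dinatural c f,
      whiskerLeft_comp, ← associator_naturality_right_assoc, ← whisker_exchange_assoc,
      leftUnitor_inv_naturality_assoc]
  have h' : ∀ X : C, splitDual X ≫ (incl c X ⊗ₘ incl c X) =
      (Xᘁ : C) ◁ ((λ_ X).inv ≫ η_ X Xᘁ ▷ X ≫ (α_ X Xᘁ X).hom ≫ X ◁ incl c X) ≫
        (α_ Xᘁ X c.pt).inv ≫ incl c X ▷ c.pt := by
    intro X
    rw [splitDual, tensorHom_def']
    simp
  dsimp only
  rw [h', h', ← whisker_exchange_assoc, associator_inv_naturality_left_assoc,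
    ← comp_whiskerRight, incl_dinatural c f, comp_whiskerRight,
    ← associator_inv_naturality_middle_assoc, ← whiskerLeft_comp_assoc,
    ← whiskerLeft_comp_assoc]
  congr 2
  rw [← h]
  simp only [Category.assoc, whisker_exchange]

end Coend

section Braided

variable {C : Type*} [Category C] [MonoidalCategory C] [BraidedCategory C] [RightRigidCategory C]
  {c : Cowedge (dualTensor C)}

/-- A family `(X* ⊗ X) ⊗ (Y* ⊗ Y) ⟶ Z` is dinatural in both variables. -/
structure Dinatural₂ {Z : C} (φ : ∀ X Y : C, (Xᘁ ⊗ X) ⊗ (Yᘁ ⊗ Y) ⟶ Z) : Prop where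
  left : ∀ ⦃X X' : C⦄ (f : X ⟶ X') (Y : C),
    (fᘁ ▷ X) ▷ (Yᘁ ⊗ Y) ≫ φ X Y = (X'ᘁ ◁ f) ▷ (Yᘁ ⊗ Y) ≫ φ X' Y
  right : ∀ (X : C) ⦃Y Y' : C⦄ (g : Y ⟶ Y'),
    (Xᘁ ⊗ X) ◁ (gᘁ ▷ Y) ≫ φ X Y = (Xᘁ ⊗ X) ◁ (Y'ᘁ ◁ g) ≫ φ X Y'

/-- Morphisms out of `c.pt ⊗ c.pt` are determined by their restrictions along `i_X ⊗ i_Y`. -/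
theorem coend_hom_ext₂ (hc : IsCoend c) {Z : C} {f g : c.pt ⊗ c.pt ⟶ Z}
    (h : ∀ X Y, (incl c X ⊗ₘ incl c Y) ≫ f = (incl c X ⊗ₘ incl c Y) ≫ g) : f = g := by
  apply tensor_coend_hom_ext hc
  intro X
  rw [← cancel_epi (β_ (Xᘁ ⊗ X) c.pt).inv]
  apply tensor_coend_hom_ext hc
  intro Y
  rw [← cancel_epi (β_ (Xᘁ ⊗ X) (Yᘁ ⊗ Y)).hom]
  have := h X Y
  simp only [tensorHom_def', Category.assoc] at this
  simpa only [← BraidedCategory.braiding_naturality_right_assoc, Iso.hom_inv_id_assoc] using this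

/-- The morphism out of `c.pt ⊗ c.pt` induced by a family which is dinatural in both variables. -/
def descCoend₂ (hc : IsCoend c) {Z : C} (φ : ∀ X Y : C, (Xᘁ ⊗ X) ⊗ (Yᘁ ⊗ Y) ⟶ Z)
    (hφ : Dinatural₂ φ) : c.pt ⊗ c.pt ⟶ Z :=
  descTensor hc
    (fun X => (β_ (Xᘁ ⊗ X) c.pt).hom ≫
      descTensor hc (fun Y => (β_ (Xᘁ ⊗ X) (Yᘁ ⊗ Y)).inv ≫ φ X Y) (by
        intro Y Y' g
        simp only [BraidedCategory.braiding_inv_naturality_left_assoc, hφ.right X g]))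
    (by
      intro X X' f
      simp only [BraidedCategory.braiding_naturality_left_assoc]
      congr 1
      apply tensor_coend_hom_ext hc
      intro Y
      simp only [← whisker_exchange_assoc, incl_descTensor]
      simp only [BraidedCategory.braiding_inv_naturality_right_assoc, hφ.left f Y])

/-- The defining property of `descCoend₂`. -/
theorem incl_descCoend₂ (hc : IsCoend c) {Z : C} (φ : ∀ X Y : C, (Xᘁ ⊗ X) ⊗ (Yᘁ ⊗ Y) ⟶ Z)
    (hφ : Dinatural₂ φ) (X Y : C) :
    (incl c X ⊗ₘ incl c Y) ≫ descCoend₂ hc φ hφ = φ X Y := by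
  rw [tensorHom_def', Category.assoc, descCoend₂, incl_descTensor,
    BraidedCategory.braiding_naturality_right_assoc, incl_descTensor, Iso.hom_inv_id_assoc]

/-! ### The Hopf algebra structure of the coend

All structure morphisms are defined by their restrictions along the morphisms `i_X`. -/

theorem ev_dinatural : Dinatural (fun X : C => ε_ X Xᘁ) :=
  fun _ _ f => rightAdjointMate_comp_evaluation f

/-- The counit `ε`, defined by `ε ∘ i_X = ev_X`. -/
def counit (hc : IsCoend c) : c.pt ⟶ 𝟙_ C :=
  descCoend hc (fun X => ε_ X Xᘁ) ev_dinatural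

theorem incl_counit (hc : IsCoend c) (X : C) : incl c X ≫ counit hc = ε_ X Xᘁ :=
  incl_descCoend hc _ _ X

/-- The coevaluation `𝟙 ⟶ X ⊗ X*`. -/
abbrev coev (X : C) : 𝟙_ C ⟶ X ⊗ Xᘁ := η_ X Xᘁ

/-- The unit `η : 𝟙 ≅ 𝟙* ⊗ 𝟙 ⟶ c.pt`, the second arrow being `i_𝟙`. -/
def unit (c : Cowedge (dualTensor C)) : 𝟙_ C ⟶ c.pt :=
  coev (𝟙_ C) ≫ (λ_ _).hom ≫ (ρ_ _).inv ≫ incl c (𝟙_ C)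

/-- The coproduct `Δ`, defined by `Δ ∘ i_X = (i_X ⊗ i_X) ∘ (id ⊗ coev_X ⊗ id)`. -/
def comul (hc : IsCoend c) : c.pt ⟶ c.pt ⊗ c.pt :=
  descCoend hc (fun X : C => splitDual X ≫ (incl c X ⊗ₘ incl c X)) (comul_dinatural c)

theorem incl_comul (hc : IsCoend c) (X : C) :
    incl c X ≫ comul hc = splitDual X ≫ (incl c X ⊗ₘ incl c X) :=
  incl_descCoend hc _ _ X

/-- The morphism `(X* ⊗ X) ⊗ (Y* ⊗ Y) ⟶ (X ⊗ Y)* ⊗ (X ⊗ Y)` which braids `Y*` past `X* ⊗ X`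
and then uses the canonical isomorphism `Y* ⊗ X* ≅ (X ⊗ Y)*`. -/
def mergeDual (X Y : C) : (Xᘁ ⊗ X) ⊗ (Yᘁ ⊗ Y) ⟶ (X ⊗ Y)ᘁ ⊗ (X ⊗ Y) :=
  (α_ (Xᘁ ⊗ X) Yᘁ Y).inv ≫ (β_ (Xᘁ ⊗ X) Yᘁ).hom ▷ Y ≫ (α_ Yᘁ Xᘁ X).inv ▷ Y ≫
    (α_ (Yᘁ ⊗ Xᘁ) X Y).hom ≫ (rightDualTensorIso X Y).inv ▷ (X ⊗ Y)

theorem mul_dinatural (c : Cowedge (dualTensor C)) :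
    Dinatural₂ (fun X Y => mergeDual X Y ≫ incl c (X ⊗ Y)) := by
  constructor
  · intro X X' f Y
    simp only [mergeDual, Category.assoc]
    rw [associator_inv_naturality_left_assoc, ← comp_whiskerRight_assoc,
      BraidedCategory.braiding_naturality_left, comp_whiskerRight_assoc,
      ← comp_whiskerRight_assoc (_ ◁ (fᘁ ▷ X)), associator_inv_naturality_middle,
      comp_whiskerRight_assoc, associator_naturality_left_assoc,
      ← comp_whiskerRight_assoc (_ ◁ fᘁ), dualTensorIso_inv_naturality_left,
      comp_whiskerRight_assoc, incl_dinatural c (f ▷ Y)]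
    have e : ((X'ᘁ : C) ◁ f) ▷ (Yᘁ ⊗ Y) ≫ (α_ (X'ᘁ ⊗ X') Yᘁ Y).inv ≫
        (β_ (X'ᘁ ⊗ X') Yᘁ).hom ▷ Y ≫ (α_ Yᘁ X'ᘁ X').inv ▷ Y ≫ (α_ (Yᘁ ⊗ X'ᘁ) X' Y).hom =
        (α_ (X'ᘁ ⊗ X) Yᘁ Y).inv ≫ (β_ (X'ᘁ ⊗ X) Yᘁ).hom ▷ Y ≫ (α_ Yᘁ X'ᘁ X).inv ▷ Y ≫
          (α_ (Yᘁ ⊗ X'ᘁ) X Y).hom ≫ (Yᘁ ⊗ X'ᘁ) ◁ (f ▷ Y) := by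
      rw [associator_inv_naturality_left_assoc, ← comp_whiskerRight_assoc,
        BraidedCategory.braiding_naturality_left, comp_whiskerRight_assoc,
        ← comp_whiskerRight_assoc (_ ◁ (_ ◁ f)), associator_inv_naturality_right,
        comp_whiskerRight_assoc, associator_naturality_middle]
    rw [reassoc_of% e, whisker_exchange_assoc]
  · intro X Y Y' g
    simp only [mergeDual, Category.assoc]
    rw [associator_inv_naturality_middle_assoc, ← comp_whiskerRight_assoc,
      BraidedCategory.braiding_naturality_right, comp_whiskerRight_assoc,
      ← comp_whiskerRight_assoc (gᘁ ▷ _), associator_inv_naturality_left,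
      comp_whiskerRight_assoc, associator_naturality_left_assoc,
      ← comp_whiskerRight_assoc (gᘁ ▷ _), dualTensorIso_inv_naturality_right,
      comp_whiskerRight_assoc, incl_dinatural c (X ◁ g)]
    rw [associator_inv_naturality_right_assoc, whisker_exchange_assoc,
      whisker_exchange_assoc, associator_naturality_right_assoc, whisker_exchange_assoc]

/-- The product `μ`, defined by
`μ ∘ (i_X ⊗ i_Y) = i_{X ⊗ Y} ∘ (c_{X* ⊗ X, Y*} ⊗ id_Y)` up to coherence isomorphisms. -/
def mul (hc : IsCoend c) : c.pt ⊗ c.pt ⟶ c.pt :=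
  descCoend₂ hc (fun X Y => mergeDual X Y ≫ incl c (X ⊗ Y)) (mul_dinatural c)

theorem incl_mul (hc : IsCoend c) (X Y : C) :
    (incl c X ⊗ₘ incl c Y) ≫ mul hc = mergeDual X Y ≫ incl c (X ⊗ Y) :=
  incl_descCoend₂ hc _ _ X Y

/-- The morphism
`(ev_X ⊗ ev_Y) ∘ (id ⊗ (c_{Y*,X} ∘ c_{X,Y*}) ⊗ id) : (X* ⊗ X) ⊗ (Y* ⊗ Y) ⟶ 𝟙`. -/
def monodromyPairing (X Y : C) : (Xᘁ ⊗ X) ⊗ (Yᘁ ⊗ Y) ⟶ 𝟙_ C :=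
  (α_ Xᘁ X (Yᘁ ⊗ Y)).hom ≫
    Xᘁ ◁ ((α_ X Yᘁ Y).inv ≫ ((β_ X Yᘁ).hom ≫ (β_ Yᘁ X).hom) ▷ Y ≫ (α_ X Yᘁ Y).hom) ≫
    (α_ Xᘁ X (Yᘁ ⊗ Y)).inv ≫ (ε_ X Xᘁ ⊗ₘ ε_ Y Yᘁ) ≫ (λ_ (𝟙_ C)).hom

theorem monodromyPairing_dinatural : Dinatural₂ (monodromyPairing (C := C)) := by
  have h : ∀ X Y : C, monodromyPairing X Y = (α_ Xᘁ X (Yᘁ ⊗ Y)).hom ≫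
      Xᘁ ◁ ((α_ X Yᘁ Y).inv ≫ ((β_ X Yᘁ).hom ≫ (β_ Yᘁ X).hom) ▷ Y ≫ (α_ X Yᘁ Y).hom ≫
        X ◁ ε_ Y Yᘁ ≫ (ρ_ X).hom) ≫ ε_ X Xᘁ := by
    intro X Y
    rw [monodromyPairing, tensorHom_def']
    simp [unitors_equal]
  have nat_left : ∀ {X X' : C} (f : X ⟶ X') (Y : C),
      f ▷ (Yᘁ ⊗ Y) ≫ (α_ X' Yᘁ Y).inv ≫ ((β_ X' Yᘁ).hom ≫ (β_ Yᘁ X').hom) ▷ Y ≫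
        (α_ X' Yᘁ Y).hom ≫ X' ◁ ε_ Y Yᘁ ≫ (ρ_ X').hom =
      ((α_ X Yᘁ Y).inv ≫ ((β_ X Yᘁ).hom ≫ (β_ Yᘁ X).hom) ▷ Y ≫
        (α_ X Yᘁ Y).hom ≫ X ◁ ε_ Y Yᘁ ≫ (ρ_ X).hom) ≫ f := by
    intro X X' f Y
    simp only [Category.assoc, comp_whiskerRight]
    rw [associator_inv_naturality_left_assoc, ← comp_whiskerRight_assoc,
      BraidedCategory.braiding_naturality_left, comp_whiskerRight_assoc,
      ← comp_whiskerRight_assoc (_ ◁ f), BraidedCategory.braiding_naturality_right,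
      comp_whiskerRight_assoc, associator_naturality_left_assoc, ← whisker_exchange_assoc,
      rightUnitor_naturality]
  have nat_right : ∀ (X : C) {Y Y' : C} (g : Y ⟶ Y'),
      X ◁ (gᘁ ▷ Y) ≫ (α_ X Yᘁ Y).inv ≫ ((β_ X Yᘁ).hom ≫ (β_ Yᘁ X).hom) ▷ Y ≫
        (α_ X Yᘁ Y).hom ≫ X ◁ ε_ Y Yᘁ ≫ (ρ_ X).hom =
      X ◁ ((Y'ᘁ : C) ◁ g) ≫ (α_ X Y'ᘁ Y').inv ≫ ((β_ X Y'ᘁ).hom ≫ (β_ Y'ᘁ X).hom) ▷ Y' ≫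
        (α_ X Y'ᘁ Y').hom ≫ X ◁ ε_ Y' Y'ᘁ ≫ (ρ_ X).hom := by
    intro X Y Y' g
    simp only [Category.assoc, comp_whiskerRight]
    rw [associator_inv_naturality_middle_assoc, ← comp_whiskerRight_assoc,
      BraidedCategory.braiding_naturality_right, comp_whiskerRight_assoc,
      ← comp_whiskerRight_assoc (gᘁ ▷ X), BraidedCategory.braiding_naturality_left,
      comp_whiskerRight_assoc, associator_naturality_middle_assoc, ← whiskerLeft_comp_assoc,
      rightAdjointMate_comp_evaluation, whiskerLeft_comp_assoc,
      associator_inv_naturality_right_assoc, whisker_exchange_assoc, whisker_exchange_assoc,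
      associator_naturality_right_assoc]
  constructor
  · intro X X' f Y
    rw [h, h, associator_naturality_left_assoc, ← whisker_exchange_assoc,
      rightAdjointMate_comp_evaluation, associator_naturality_middle_assoc,
      ← whiskerLeft_comp_assoc, ← whiskerLeft_comp_assoc, nat_left]
  · intro X Y Y' g
    rw [h, h, associator_naturality_right_assoc, associator_naturality_right_assoc,
      ← whiskerLeft_comp_assoc, ← whiskerLeft_comp_assoc, nat_right]

/-- The Hopf pairing `ω`, defined by
`ω ∘ (i_X ⊗ i_Y) = (ev_X ⊗ ev_Y) ∘ (id ⊗ (c_{Y*,X} ∘ c_{X,Y*}) ⊗ id)`. -/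
def hopfPairing (hc : IsCoend c) : c.pt ⊗ c.pt ⟶ 𝟙_ C :=
  descCoend₂ hc monodromyPairing monodromyPairing_dinatural

theorem incl_hopfPairing (hc : IsCoend c) (X Y : C) :
    (incl c X ⊗ₘ incl c Y) ≫ hopfPairing hc = monodromyPairing X Y :=
  incl_descCoend₂ hc _ _ X Y

/-- A pairing `p : A ⊗ A ⟶ 𝟙` is non-degenerate if the induced morphism
`(p ⊗ id) ∘ (id ⊗ coev_A) : A ⟶ A*` is an isomorphism. -/
def IsNondegenerate {A : C} (p : A ⊗ A ⟶ 𝟙_ C) : Prop :=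
  IsIso ((ρ_ A).inv ≫ A ◁ η_ A Aᘁ ≫ (α_ A A Aᘁ).inv ≫ p ▷ Aᘁ ≫ (λ_ Aᘁ).hom)

/-! ### Integrals and cointegrals -/

/-- A right integral `Λ : 𝟙 ⟶ c.pt` of the coend: `μ ∘ (Λ ⊗ id) = Λ ∘ ε`. (In a modular category
left and right integrals coincide.) -/
def IsRightIntegral (hc : IsCoend c) (Λ : 𝟙_ C ⟶ c.pt) : Prop :=
  (λ_ c.pt).inv ≫ Λ ▷ c.pt ≫ mul hc = counit hc ≫ Λ

/-- A (two-sided) cointegral `Λco : c.pt ⟶ 𝟙` of the coend: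
`(Λco ⊗ id) ∘ Δ = η ∘ Λco` and `(id ⊗ Λco) ∘ Δ = η ∘ Λco`. -/
structure IsCointegral (hc : IsCoend c) (Λco : c.pt ⟶ 𝟙_ C) : Prop where
  right : comul hc ≫ Λco ▷ c.pt ≫ (λ_ c.pt).hom = Λco ≫ unit c
  left : comul hc ≫ c.pt ◁ Λco ≫ (ρ_ c.pt).hom = Λco ≫ unit c

end Braided

section Ribbon

variable {C : Type*} [Category C] [MonoidalCategory C] [BraidedCategory C] [RightRigidCategory C]
  [RibbonCategory C] {c : Cowedge (dualTensor C)}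

/-! ### The T-transformation -/

/-- The T-transformation of the coend, defined by `T ∘ i_X = i_X ∘ (id ⊗ θ_X)`; its inverse
satisfies `T⁻¹ ∘ i_X = i_X ∘ (id ⊗ θ_X⁻¹)`. -/
@[simps]
def tTransformation (hc : IsCoend c) : c.pt ≅ c.pt where
  hom := descCoend hc (fun X : C => (Xᘁ : C) ◁ twist.hom.app X ≫ incl c X) (twist_dinatural c _)
  inv := descCoend hc (fun X : C => (Xᘁ : C) ◁ twist.inv.app X ≫ incl c X) (twist_dinatural c _)
  hom_inv_id := by
    apply coend_hom_ext hc
    intro X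
    rw [← Category.assoc, incl_descCoend, Category.assoc, incl_descCoend,
      ← whiskerLeft_comp_assoc, twist.hom_inv_id_app]
    simp
  inv_hom_id := by
    apply coend_hom_ext hc
    intro X
    rw [← Category.assoc, incl_descCoend, Category.assoc, incl_descCoend,
      ← whiskerLeft_comp_assoc, twist.inv_hom_id_app]
    simp

end Ribbon

section Modular

universe w

variable (k : Type w) [Field k] (C : Type*) [Category C] [Preadditive C] [Linear k C]

/-! ### Modular categories -/

/-- A `k`-linear category is finite if it is equivalent, as a `k`-linear category, to the category
of finite-dimensional left modules over a finite-dimensional `k`-algebra `A` (over such an `A`,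
finitely generated and finite-dimensional modules are the same). -/
def IsFiniteLinear : Prop :=
  ∃ (A : Type w) (_ : Ring A) (_ : Algebra k A) (_ : Module.Finite k A)
    (F : C ⥤ FGModuleCat.{w} A), F.IsEquivalence ∧ F.Additive ∧ F.Linear k

/-- A braided rigid category is factorizable if the Hopf pairing of the coend `∫^X X* ⊗ X` is
non-degenerate. -/
def IsFactorizable (C : Type*) [Category C] [MonoidalCategory C] [BraidedCategory C]
    [RightRigidCategory C] : Prop :=
  ∀ (c : Cowedge (dualTensor C)) (hc : IsCoend c), IsNondegenerate (hopfPairing hc)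

/-- A modular category: a ribbon category with bilinear tensor product which is finite, has a
simple tensor unit and is factorizable. It need not be semisimple. -/
structure IsModular [MonoidalCategory C] [MonoidalPreadditive C] [MonoidalLinear k C]
    [BraidedCategory C] [RightRigidCategory C] [RibbonCategory C] : Prop where
  finite : IsFiniteLinear k C
  simple_unit : Simple (𝟙_ C)
  factorizable : IsFactorizable C

variable [MonoidalCategory C] [BraidedCategory C] [RightRigidCategory C] [RibbonCategory C]
variable {C} {c : Cowedge (dualTensor C)}

/-! ### Stabilization coefficients and the modularity parameter -/

/-- `d` is the stabilization coefficient `Δ₊` of `Λ`: `ε ∘ T ∘ Λ = d • id`. -/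
def IsStabilizationCoeffPlus (hc : IsCoend c) (Λ : 𝟙_ C ⟶ c.pt) (d : k) : Prop :=
  Λ ≫ (tTransformation hc).hom ≫ counit hc = d • 𝟙 (𝟙_ C)

/-- `d` is the stabilization coefficient `Δ₋` of `Λ`: `ε ∘ T⁻¹ ∘ Λ = d • id`. -/
def IsStabilizationCoeffMinus (hc : IsCoend c) (Λ : 𝟙_ C ⟶ c.pt) (d : k) : Prop :=
  Λ ≫ (tTransformation hc).inv ≫ counit hc = d • 𝟙 (𝟙_ C)

/-- `ζ` is the modularity parameter of the integral `Λ`: it is non-zero and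
`ω ∘ (Λ ⊗ id) = ζ • Λco`, where `Λco` is a cointegral with `Λco ∘ Λ = id`. -/
def IsModularityParameter (hc : IsCoend c) (Λ : 𝟙_ C ⟶ c.pt) (ζ : k) : Prop :=
  ζ ≠ 0 ∧ ∃ Λco : c.pt ⟶ 𝟙_ C, IsCointegral hc Λco ∧ Λ ≫ Λco = 𝟙 (𝟙_ C) ∧
    (λ_ c.pt).inv ≫ Λ ▷ c.pt ≫ hopfPairing hc = ζ • Λco

variable (C) in
/-- Twist non-degeneracy: the stabilization coefficients `Δ₊` and `Δ₋` associated with a non-zero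
integral of the coend are non-zero. -/
def IsTwistNondegenerate : Prop :=
  ∀ (c : Cowedge (dualTensor C)) (hc : IsCoend c) (Λ : 𝟙_ C ⟶ c.pt),
    IsRightIntegral hc Λ → Λ ≠ 0 →
    ∃ dp dm : k, dp ≠ 0 ∧ dm ≠ 0 ∧
      IsStabilizationCoeffPlus k hc Λ dp ∧ IsStabilizationCoeffMinus k hc Λ dm

end Modular
end RibbonCategory

/-! Every object `X` carries a coaction `X ⟶ X ⊗ A` of the coend `A`, and by universality a morphism
`A ⊗ W ⟶ Z` amounts to a natural family `X ⊗ W ⟶ X ⊗ Z` (`fam`). Identities between morphisms out of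
`A` and `A ⊗ A` become identities between braidings and twists. In this dictionary `μ` gives the
coaction on `X ⊗ Y` (`coact_tensor`), `T` gives the twist, and `ω` gives the inverse double braiding
(`fam_act_hopfPairing`). The balancing axiom then reads `ω = ε ∘ T⁻¹ ∘ μ ∘ (T ⊗ T)`
(`hopfPairing_eq`).

For an integral `Λ`, factorizability makes both `ω ∘ (Λ ⊗ id)` and `ω ∘ (id ⊗ Λ)` cointegrals
(`isCointegral_pairingLeft`, `isCointegral_pairingRight`), and cointegrals are invariant under
`T⁻¹`. Hence `ω(Λ, Λ) = ω(T⁻¹Λ, Λ) = ε T⁻¹ μ(Λ, TΛ) = ε(TΛ) · ε(T⁻¹Λ) = Δ₊ Δ₋`, the third equality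
being the integral property (`comp_pairingLeft_self`). On the other hand `ω(Λ, Λ) = ζ`, because `ω ∘
(Λ ⊗ id) = ζ Λco` and `Λco ∘ Λ = id`.

The existence of a nonzero `ζ` requires `x ∘ Λ ≠ 0` for the nonzero cointegral `x = ω ∘ (Λ ⊗ id)`.
If `x ∘ Λ = 0`, an antipode argument gives `Λ ∘ x = 0` (`cointegral_comp_integral_eq_zero`); since
`Λ` is a monomorphism out of a simple object, `x = 0`, a contradiction. -/

namespace RibbonCategory

/-! ### The universal coaction, and morphisms out of the coend as natural families. -/

section Coaction

variable {C : Type*} [Category C] [MonoidalCategory C] [RightRigidCategory C]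

/-- The universal coaction `X ⟶ X ⊗ A` of the coend `A` on an object `X`. -/
def coact (c : Cowedge (dualTensor C)) (X : C) : X ⟶ X ⊗ c.pt :=
  (λ_ X).inv ≫ η_ X Xᘁ ▷ X ≫ (α_ X Xᘁ X).hom ≫ X ◁ incl c X

variable (c : Cowedge (dualTensor C))

theorem coact_naturality {X Y : C} (f : X ⟶ Y) :
    f ≫ coact c Y = coact c X ≫ f ▷ c.pt := by
  symm
  simp only [coact, Category.assoc, whisker_exchange]
  rw [← associator_naturality_left_assoc, ← comp_whiskerRight_assoc,
    ← coevaluation_comp_rightAdjointMate, comp_whiskerRight_assoc,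
    associator_naturality_middle_assoc, ← whiskerLeft_comp, incl_dinatural c f,
    whiskerLeft_comp, ← associator_naturality_right_assoc, ← whisker_exchange_assoc,
    leftUnitor_inv_naturality_assoc]

/-- Straightening a strand which is created by a coevaluation and annihilated by an evaluation. -/
theorem dual_zigzag_left (X W : C) :
    (Xᘁ : C) ◁ ((λ_ W).inv ≫ η_ X Xᘁ ▷ W ≫ (α_ X Xᘁ W).hom) ≫ (α_ Xᘁ X (Xᘁ ⊗ W)).inv ≫
      ε_ X Xᘁ ▷ (Xᘁ ⊗ W) ≫ (λ_ (Xᘁ ⊗ W)).hom = 𝟙 _ := by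
  calc
    _ = 𝟙 _ ⊗≫ ((Xᘁ : C) ◁ η_ X Xᘁ ⊗≫ ε_ X Xᘁ ▷ (Xᘁ : C)) ▷ W ⊗≫ 𝟙 _ := by monoidal
    _ = _ := by rw [ExactPairing.coevaluation_evaluation'']; monoidal

theorem dual_zigzag_right (X W : C) :
    (λ_ (X ⊗ W)).inv ≫ η_ X Xᘁ ▷ (X ⊗ W) ≫ (α_ X Xᘁ (X ⊗ W)).hom ≫
      X ◁ ((α_ Xᘁ X W).inv ≫ ε_ X Xᘁ ▷ W ≫ (λ_ W).hom) = 𝟙 _ := by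
  calc
    _ = 𝟙 _ ⊗≫ (η_ X Xᘁ ▷ X ⊗≫ X ◁ ε_ X Xᘁ) ▷ W ⊗≫ 𝟙 _ := by monoidal
    _ = _ := by rw [ExactPairing.evaluation_coevaluation'']; monoidal

theorem incl_eq (X : C) :
    incl c X = (Xᘁ : C) ◁ coact c X ≫ (α_ Xᘁ X c.pt).inv ≫ ε_ X Xᘁ ▷ c.pt ≫ (λ_ c.pt).hom := by
  have := dual_zigzag_left X X
  calc incl c X = 𝟙 _ ≫ incl c X := by simp
    _ = _ := by
      rw [← this]
      simp only [coact, whiskerLeft_comp, Category.assoc]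
      rw [associator_inv_naturality_right_assoc, whisker_exchange_assoc, leftUnitor_naturality]

/-- The family `X ⊗ W ⟶ X ⊗ Z` corresponding to a morphism `A ⊗ W ⟶ Z`. -/
def fam {W Z : C} (f : c.pt ⊗ W ⟶ Z) (X : C) : X ⊗ W ⟶ X ⊗ Z :=
  coact c X ▷ W ≫ (α_ X c.pt W).hom ≫ X ◁ f

theorem incl_whiskerRight_comp {W Z : C} (f : c.pt ⊗ W ⟶ Z) (X : C) :
    incl c X ▷ W ≫ f = (α_ Xᘁ X W).hom ≫ (Xᘁ : C) ◁ fam c f X ≫ (α_ Xᘁ X Z).inv ≫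
      ε_ X Xᘁ ▷ Z ≫ (λ_ Z).hom := by
  rw [incl_eq, fam]
  calc
    _ = 𝟙 _ ⊗≫ (Xᘁ : C) ◁ coact c X ▷ W ⊗≫ (ε_ X Xᘁ ▷ (c.pt ⊗ W) ≫ 𝟙_ C ◁ f) ⊗≫ 𝟙 _ := by monoidal
    _ = _ := by rw [← whisker_exchange]; monoidal

theorem fam_eq {W Z : C} (f : c.pt ⊗ W ⟶ Z) (X : C) :
    fam c f X = (λ_ (X ⊗ W)).inv ≫ η_ X Xᘁ ▷ (X ⊗ W) ≫ (α_ X Xᘁ (X ⊗ W)).hom ≫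
      X ◁ ((α_ Xᘁ X W).inv ≫ incl c X ▷ W ≫ f) := by
  rw [fam, coact]
  monoidal

-- This lets equations between morphisms out of `A ⊗ W` be checked on ordinary objects:
-- `incl_whiskerRight_comp` recovers the restriction along `i_X` from the family by evaluation.
variable {c} in
theorem fam_ext (hc : IsCoend c) {W Z : C} {f g : c.pt ⊗ W ⟶ Z}
    (h : ∀ X, fam c f X = fam c g X) : f = g := by
  apply tensor_coend_hom_ext hc
  intro X
  rw [incl_whiskerRight_comp, incl_whiskerRight_comp, h]

end Coaction

section Corestriction

variable {C : Type*} [Category C] [MonoidalCategory C] [RightRigidCategory C]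

theorem coact_eq_of_incl_eq (c : Cowedge (dualTensor C)) {X : C} (d : X ⟶ X ⊗ c.pt)
    (h : (Xᘁ : C) ◁ d ≫ (α_ Xᘁ X c.pt).inv ≫ ε_ X Xᘁ ▷ c.pt ≫ (λ_ c.pt).hom = incl c X) :
    coact c X = d := by
  rw [coact, ← h]
  calc
    _ = 𝟙 _ ⊗≫ (η_ X Xᘁ ▷ X ≫ (X ⊗ Xᘁ) ◁ d) ⊗≫ X ◁ ε_ X Xᘁ ▷ c.pt ⊗≫ 𝟙 _ := by monoidal
    _ = d ≫ (λ_ (X ⊗ c.pt)).inv ≫ η_ X Xᘁ ▷ (X ⊗ c.pt) ≫ (α_ X Xᘁ (X ⊗ c.pt)).hom ≫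
      X ◁ ((α_ Xᘁ X c.pt).inv ≫ ε_ X Xᘁ ▷ c.pt ≫ (λ_ c.pt).hom) := by
      rw [← whisker_exchange]; monoidal
    _ = d := by rw [dual_zigzag_right, Category.comp_id]

theorem fam_comp (c : Cowedge (dualTensor C)) {W Z Z' : C} (f : c.pt ⊗ W ⟶ Z) (g : Z ⟶ Z')
    (X : C) : fam c (f ≫ g) X = fam c f X ≫ X ◁ g := by
  simp [fam]

theorem fam_whiskerLeft_comp (c : Cowedge (dualTensor C)) {W' W Z : C} (f : c.pt ⊗ W ⟶ Z)
    (g : W' ⟶ W) (X : C) : fam c (c.pt ◁ g ≫ f) X = X ◁ g ≫ fam c f X := by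
  simp [fam, whisker_exchange_assoc]

theorem coact_comp_of_incl_comp (c : Cowedge (dualTensor C)) {X : C} {f : c.pt ⟶ c.pt}
    {t : X ⟶ X} (h : incl c X ≫ f = (Xᘁ : C) ◁ t ≫ incl c X) :
    coact c X ≫ X ◁ f = t ≫ coact c X := by
  calc
    _ = (λ_ X).inv ≫ η_ X Xᘁ ▷ X ≫ (α_ X Xᘁ X).hom ≫ X ◁ (incl c X ≫ f) := by simp [coact]
    _ = 𝟙 _ ⊗≫ (η_ X Xᘁ ▷ X ≫ (X ⊗ Xᘁ) ◁ t) ⊗≫ X ◁ incl c X := by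
      rw [h]
      monoidal
    _ = _ := by
      rw [← whisker_exchange, coact]
      monoidal

end Corestriction

/-! ### Coactions versus coproduct, counit, unit and product. -/

section Braided

variable {C : Type*} [Category C] [MonoidalCategory C] [BraidedCategory C] [RightRigidCategory C]
  {c : Cowedge (dualTensor C)}

theorem coact_comul (hc : IsCoend c) (X : C) :
    coact c X ≫ X ◁ comul hc = coact c X ≫ coact c X ▷ c.pt ≫ (α_ X c.pt c.pt).hom := by
  calc
    _ = (λ_ X).inv ≫ η_ X Xᘁ ▷ X ≫ (α_ X Xᘁ X).hom ≫ X ◁ (incl c X ≫ comul hc) := by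
      simp [coact]
    _ = 𝟙 _ ⊗≫ (η_ X Xᘁ ▷ (𝟙_ C ⊗ X) ≫ (X ⊗ Xᘁ) ◁ η_ X Xᘁ ▷ X) ⊗≫
        X ◁ incl c X ▷ (Xᘁ ⊗ X) ⊗≫ (X ⊗ c.pt) ◁ incl c X ⊗≫ 𝟙 _ := by
      rw [incl_comul, splitDual, MonoidalCategory.tensorHom_def]
      monoidal
    _ = 𝟙 _ ⊗≫ η_ X Xᘁ ▷ X ⊗≫ (coact c X ▷ (Xᘁ ⊗ X) ≫ (X ⊗ c.pt) ◁ incl c X) ⊗≫ 𝟙 _ := by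
      rw [← whisker_exchange, coact]
      monoidal
    _ = _ := by
      rw [← whisker_exchange]
      nth_rw 2 [coact]
      monoidal

theorem coact_counit (hc : IsCoend c) (X : C) :
    coact c X ≫ X ◁ counit hc = (ρ_ X).inv := by
  calc
    _ = (λ_ X).inv ≫ η_ X Xᘁ ▷ X ≫ (α_ X Xᘁ X).hom ≫ X ◁ (incl c X ≫ counit hc) := by
      simp [coact]
    _ = _ := by
      rw [incl_counit, ExactPairing.evaluation_coevaluation]
      simp

theorem unit_whiskerRight_eq {D : C} (e : 𝟙_ C ⟶ 𝟙_ C ⊗ D) :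
    (λ_ (𝟙_ C)).inv ≫ e ▷ 𝟙_ C ≫ (α_ (𝟙_ C) D (𝟙_ C)).hom =
      (λ_ (𝟙_ C)).inv ≫ 𝟙_ C ◁ (e ≫ (λ_ D).hom ≫ (ρ_ D).inv) := by
  rw [unitors_inv_equal, ← cancel_epi (ρ_ (𝟙_ C)).hom]
  monoidal

theorem coact_unit (c : Cowedge (dualTensor C)) :
    coact c (𝟙_ C) = (λ_ (𝟙_ C)).inv ≫ 𝟙_ C ◁ unit c := by
  have := unit_whiskerRight_eq (coev (𝟙_ C))
  simp only [coact, unit, whiskerLeft_comp] at this ⊢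
  rw [reassoc_of% this]

/-- The morphism `B ⊗ Y ⟶ Y ⊗ Z` obtained from `B ⊗ A ⟶ Z` and the coaction on `Y`. -/
def act {B Z : C} (f : B ⊗ c.pt ⟶ Z) (Y : C) : B ⊗ Y ⟶ Y ⊗ Z :=
  B ◁ coact c Y ≫ (α_ B Y c.pt).inv ≫ (β_ B Y).hom ▷ c.pt ≫ (α_ Y B c.pt).hom ≫ Y ◁ f

theorem whiskerLeft_incl_comp {B Z : C} (f : B ⊗ c.pt ⟶ Z) (Y : C) :
    B ◁ incl c Y ≫ f = (α_ B Yᘁ Y).inv ≫ (β_ B Yᘁ).hom ▷ Y ≫ (α_ Yᘁ B Y).hom ≫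
      (Yᘁ : C) ◁ act f Y ≫ (α_ Yᘁ Y Z).inv ≫ ε_ Y Yᘁ ▷ Z ≫ (λ_ Z).hom := by
  calc
    _ = 𝟙 _ ⊗≫ B ◁ (Yᘁ : C) ◁ coact c Y ⊗≫ (B ◁ ε_ Y Yᘁ ≫ (β_ B (𝟙_ C)).hom) ▷ c.pt ⊗≫ f := by
      rw [incl_eq, braiding_tensorUnit_right]
      monoidal
    _ = 𝟙 _ ⊗≫ (B ⊗ Yᘁ) ◁ coact c Y ⊗≫ (β_ B (Yᘁ ⊗ Y)).hom ▷ c.pt ⊗≫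
        (ε_ Y Yᘁ ▷ (B ⊗ c.pt) ≫ 𝟙_ C ◁ f) ⊗≫ 𝟙 _ := by
      rw [BraidedCategory.braiding_naturality_right]
      monoidal
    _ = 𝟙 _ ⊗≫ ((B ⊗ Yᘁ) ◁ coact c Y ≫ (β_ B Yᘁ).hom ▷ (Y ⊗ c.pt)) ⊗≫
      (Yᘁ : C) ◁ (β_ B Y).hom ▷ c.pt ⊗≫
        (Yᘁ ⊗ Y) ◁ f ⊗≫ ε_ Y Yᘁ ▷ Z ⊗≫ 𝟙 _ := by
      rw [← whisker_exchange, BraidedCategory.braiding_tensor_right_hom]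
      monoidal
    _ = _ := by
      rw [whisker_exchange, act]
      monoidal

theorem act_ext (hc : IsCoend c) {B Z : C} {f g : B ⊗ c.pt ⟶ Z}
    (h : ∀ Y, act f Y = act g Y) : f = g := by
  rw [← cancel_epi (β_ B c.pt).inv]
  apply tensor_coend_hom_ext hc
  intro X
  rw [BraidedCategory.braiding_inv_naturality_left_assoc,
    BraidedCategory.braiding_inv_naturality_left_assoc, whiskerLeft_incl_comp,
    whiskerLeft_incl_comp, h]

/-- The coaction on a tensor product is given by the product of the coend. -/
theorem coact_tensor (hc : IsCoend c) (X Y : C) :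
    coact c (X ⊗ Y) = fam c (act (mul hc) Y) X ≫ (α_ X Y c.pt).inv := by
  apply coact_eq_of_incl_eq
  have h := incl_mul hc X Y
  rw [MonoidalCategory.tensorHom_def, Category.assoc, whiskerLeft_incl_comp,
    associator_inv_naturality_left_assoc, ← comp_whiskerRight_assoc,
    BraidedCategory.braiding_naturality_left, comp_whiskerRight_assoc,
    associator_naturality_middle_assoc, ← whiskerLeft_comp_assoc, incl_whiskerRight_comp,
    mergeDual] at h
  simp only [Category.assoc] at h
  rw [cancel_epi, cancel_epi] at h
  -- Precomposing with these isomorphisms reproduces the part of `mergeDual` left after the braiding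
  -- is cancelled, so the definition of `μ` applies.
  rw [← cancel_epi ((rightDualTensorIso X Y).inv ▷ (X ⊗ Y)), ← cancel_epi (α_ (Yᘁ ⊗ Xᘁ) X Y).hom,
    ← cancel_epi ((α_ Yᘁ Xᘁ X).inv ▷ Y), ← h]
  calc
    _ = 𝟙 _ ⊗≫ ((rightDualTensorIso X Y).inv ▷ (X ⊗ Y) ≫
      (X ⊗ Y)ᘁ ◁ (fam c (act (mul hc) Y) X)) ⊗≫ ε_ (X ⊗ Y) (X ⊗ Y)ᘁ ▷ c.pt ⊗≫ 𝟙 _ := by monoidal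
    _ = 𝟙 _ ⊗≫ (Yᘁ ⊗ Xᘁ : C) ◁ (fam c (act (mul hc) Y) X) ⊗≫ ((rightDualTensorIso X Y).inv ▷ (X ⊗ Y) ≫
       ε_ (X ⊗ Y) (X ⊗ Y)ᘁ) ▷ c.pt ⊗≫ 𝟙 _ := by rw [← whisker_exchange]; monoidal
    _ = _ := by
      rw [dualTensorIso_inv_evaluation]
      monoidal

end Braided

section Ribbon

variable {C : Type*} [Category C] [MonoidalCategory C] [BraidedCategory C] [RightRigidCategory C]
  [RibbonCategory C] {c : Cowedge (dualTensor C)}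

theorem coact_tTransformation_hom (hc : IsCoend c) (X : C) :
    coact c X ≫ X ◁ (tTransformation hc).hom = twist.hom.app X ≫ coact c X :=
  coact_comp_of_incl_comp c (incl_descCoend hc _ (twist_dinatural c _) X)

theorem coact_tTransformation_inv (hc : IsCoend c) (X : C) :
    coact c X ≫ X ◁ (tTransformation hc).inv = twist.inv.app X ≫ coact c X :=
  coact_comp_of_incl_comp c (incl_descCoend hc _ (twist_dinatural c _) X)

end Ribbon

/-! ### The double braiding. -/

section Monodromy

variable {C : Type*} [Category C] [MonoidalCategory C] [BraidedCategory C]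

/-- The double braiding of two objects. -/
def monodromy (X Y : C) : X ⊗ Y ≅ X ⊗ Y := β_ X Y ≪≫ β_ Y X

theorem monodromy_naturality_right (X : C) {Y Y' : C} (f : Y ⟶ Y') :
    X ◁ f ≫ (monodromy X Y').hom = (monodromy X Y).hom ≫ X ◁ f := by
  simp [monodromy]

theorem monodromy_naturality_left {X X' : C} (f : X ⟶ X') (Y : C) :
    f ▷ Y ≫ (monodromy X' Y).hom = (monodromy X Y).hom ≫ f ▷ Y := by
  simp [monodromy]

theorem monodromy_unit_right (X : C) : (monodromy X (𝟙_ C)).hom = 𝟙 _ := by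
  simp [monodromy, braiding_tensorUnit_left, braiding_tensorUnit_right]

theorem monodromy_unit_left (X : C) : (monodromy (𝟙_ C) X).hom = 𝟙 _ := by
  simp [monodromy, braiding_tensorUnit_left, braiding_tensorUnit_right]

theorem monodromy_tensor_right (X Y Z : C) :
    (monodromy X (Y ⊗ Z)).hom = (α_ X Y Z).inv ≫ (β_ X Y).hom ▷ Z ≫ (α_ Y X Z).hom ≫
      Y ◁ (monodromy X Z).hom ≫ (α_ Y X Z).inv ≫ (β_ Y X).hom ▷ Z ≫ (α_ X Y Z).hom := by
  simp [monodromy, BraidedCategory.braiding_tensor_right_hom,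
    BraidedCategory.braiding_tensor_left_hom]

theorem monodromy_tensor_left (X Y Z : C) :
    (monodromy (X ⊗ Y) Z).hom = (α_ X Y Z).hom ≫ X ◁ (β_ Y Z).hom ≫ (α_ X Z Y).inv ≫
      (monodromy X Z).hom ▷ Y ≫ (α_ X Z Y).hom ≫ X ◁ (β_ Z Y).hom ≫ (α_ X Y Z).inv := by
  simp [monodromy, BraidedCategory.braiding_tensor_right_hom,
    BraidedCategory.braiding_tensor_left_hom]

end Monodromy

/-! ### The Hopf pairing as inverse double braiding. -/

section Pairing

variable {C : Type*} [Category C] [MonoidalCategory C] [BraidedCategory C] [RightRigidCategory C]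
  {c : Cowedge (dualTensor C)}

theorem coact_braiding (c : Cowedge (dualTensor C)) (X Y : C) :
    coact c X ▷ Y ≫ (α_ X c.pt Y).hom ≫ X ◁ (β_ c.pt Y).hom = (β_ X Y).hom ≫ Y ◁ coact c X ≫
      (α_ Y X c.pt).inv ≫ (β_ X Y).inv ▷ c.pt ≫ (α_ X Y c.pt).hom := by
  rw [← BraidedCategory.braiding_naturality_left_assoc,
    BraidedCategory.braiding_tensor_left_hom]
  simp

/-- By naturality of the braiding (`coact_braiding`), the crossing of `A` with `Y` inside `act` is
traded for crossings of `X` with `Y`. -/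
theorem fam_act {Z : C} (f : c.pt ⊗ c.pt ⟶ Z) (X Y : C) :
    fam c (act f Y) X = X ◁ coact c Y ≫ (α_ X Y c.pt).inv ≫ (β_ X Y).hom ▷ c.pt ≫
      (α_ Y X c.pt).hom ≫ Y ◁ fam c f X ≫ (α_ Y X Z).inv ≫ (β_ X Y).inv ▷ Z ≫
        (α_ X Y Z).hom := by
  calc
    _ = 𝟙 _ ⊗≫ (coact c X ▷ Y ≫ (X ⊗ c.pt) ◁ coact c Y) ⊗≫ X ◁ (β_ c.pt Y).hom ▷ c.pt ⊗≫
        (X ⊗ Y) ◁ f ⊗≫ 𝟙 _ := by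
      rw [fam, act]
      monoidal
    _ = 𝟙 _ ⊗≫ X ◁ coact c Y ⊗≫ (coact c X ▷ Y ≫ (α_ X c.pt Y).hom ≫ X ◁ (β_ c.pt Y).hom) ▷ c.pt
        ⊗≫ (X ⊗ Y) ◁ f ⊗≫ 𝟙 _ := by
      rw [← whisker_exchange]
      monoidal
    _ = 𝟙 _ ⊗≫ X ◁ coact c Y ⊗≫ (β_ X Y).hom ▷ c.pt ⊗≫ Y ◁ coact c X ▷ c.pt ⊗≫
        ((β_ X Y).inv ▷ (c.pt ⊗ c.pt) ≫ (X ⊗ Y) ◁ f) ⊗≫ 𝟙 _ := by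
      rw [coact_braiding]
      monoidal
    _ = _ := by
      rw [← whisker_exchange, fam]
      monoidal

theorem whiskerLeft_incl_fam_hopfPairing (hc : IsCoend c) (X Y : C) :
    X ◁ incl c Y ≫ fam c (hopfPairing hc) X =
      (α_ X Yᘁ Y).inv ≫ (monodromy X (Yᘁ)).hom ▷ Y ≫ (α_ X Yᘁ Y).hom ≫ X ◁ ε_ Y Yᘁ := by
  calc
    _ = 𝟙 _ ⊗≫ (η_ X Xᘁ ▷ (X ⊗ Yᘁ ⊗ Y)) ⊗≫
          X ◁ ((incl c X ⊗ₘ incl c Y) ≫ hopfPairing hc) := by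
      rw [← fam_whiskerLeft_comp, fam_eq, MonoidalCategory.tensorHom_def]
      monoidal
    _ = 𝟙 _ ⊗≫ (η_ X Xᘁ ▷ (X ⊗ Yᘁ ⊗ Y) ≫ (X ⊗ Xᘁ) ◁ ((α_ X Yᘁ Y).inv ≫
          (monodromy X (Yᘁ)).hom ▷ Y ≫ (α_ X Yᘁ Y).hom ≫ X ◁ ε_ Y Yᘁ)) ⊗≫
          X ◁ ε_ X Xᘁ ⊗≫ 𝟙 _ := by
      rw [incl_hopfPairing, monodromyPairing, tensorHom_def', monodromy, Iso.trans_hom]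
      monoidal
    _ = ((α_ X Yᘁ Y).inv ≫ (monodromy X (Yᘁ)).hom ▷ Y ≫ (α_ X Yᘁ Y).hom ≫ X ◁ ε_ Y Yᘁ) ≫
        (λ_ (X ⊗ 𝟙_ C)).inv ≫ η_ X Xᘁ ▷ (X ⊗ 𝟙_ C) ≫ (α_ X Xᘁ (X ⊗ 𝟙_ C)).hom ≫
      X ◁ ((α_ Xᘁ X (𝟙_ C)).inv ≫ ε_ X Xᘁ ▷ 𝟙_ C ≫ (λ_ (𝟙_ C)).hom) := by
      rw [← whisker_exchange]
      monoidal
    _ = _ := by rw [dual_zigzag_right, Category.comp_id]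

/-- By definition `ω` wraps `X` around `Y*`, not around `Y`. Composing with the double braiding of
`X` and `Y` makes `X` wrap around `Y ⊗ Y*`; this loop slides off the coevaluation, so the two double
braidings are inverse to each other. -/
theorem fam_act_hopfPairing (hc : IsCoend c) (X Y : C) :
    fam c (act (hopfPairing hc) Y) X = (monodromy X Y).inv ≫ X ◁ (ρ_ Y).inv := by
  rw [← cancel_mono (X ◁ (ρ_ Y).hom), ← cancel_mono (monodromy X Y).hom]
  simp only [Category.assoc, ← whiskerLeft_comp_assoc, Iso.inv_hom_id, whiskerLeft_id,
    Category.id_comp]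
  calc
    _ = 𝟙 _ ⊗≫ X ◁ η_ Y Yᘁ ▷ Y ⊗≫ (X ◁ Y ◁ incl c Y ⊗≫ (β_ X Y).hom ▷ c.pt) ⊗≫
        Y ◁ fam c (hopfPairing hc) X ⊗≫ (β_ Y X).hom ⊗≫ 𝟙 _ := by
      rw [fam_act, monodromy, Iso.trans_hom]
      have : (β_ X Y).inv ▷ 𝟙_ C ⊗≫ (β_ X Y).hom = 𝟙 _ ⊗≫ 𝟙 _ := by
        calc _ = ((β_ X Y).inv ≫ (β_ X Y).hom) ▷ 𝟙_ C ⊗≫ 𝟙 _ := by monoidal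
          _ = _ := by rw [Iso.inv_hom_id]; monoidal
      calc
        _ = 𝟙 _ ⊗≫ X ◁ coact c Y ⊗≫ (β_ X Y).hom ▷ c.pt ⊗≫ Y ◁ fam c (hopfPairing hc) X ⊗≫
          ((β_ X Y).inv ▷ 𝟙_ C ⊗≫ (β_ X Y).hom) ⊗≫ (β_ Y X).hom ⊗≫ 𝟙 _ := by monoidal
        _ = _ := by
          rw [this, coact]
          monoidal
    _ = 𝟙 _ ⊗≫ X ◁ η_ Y Yᘁ ▷ Y ⊗≫ ((X ⊗ Y) ◁ incl c Y ≫ (β_ X Y).hom ▷ c.pt) ⊗≫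
        Y ◁ fam c (hopfPairing hc) X ⊗≫ (β_ Y X).hom ⊗≫ 𝟙 _ := by monoidal
    _ = 𝟙 _ ⊗≫ X ◁ η_ Y Yᘁ ▷ Y ⊗≫ (β_ X Y).hom ▷ (Yᘁ ⊗ Y) ⊗≫
        Y ◁ (X ◁ incl c Y ≫ fam c (hopfPairing hc) X) ⊗≫ (β_ Y X).hom ⊗≫ 𝟙 _ := by
      rw [whisker_exchange]; monoidal
    _ = 𝟙 _ ⊗≫ X ◁ η_ Y Yᘁ ▷ Y ⊗≫ (β_ X Y).hom ▷ (Yᘁ ⊗ Y) ⊗≫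
        Y ◁ (monodromy X (Yᘁ)).hom ▷ Y ⊗≫ ((Y ⊗ X) ◁ ε_ Y Yᘁ ≫ (β_ Y X).hom ▷ (𝟙_ C)) ⊗≫ 𝟙 _ := by
      rw [whiskerLeft_incl_fam_hopfPairing]
      monoidal
    _ = 𝟙 _ ⊗≫ (X ◁ η_ Y Yᘁ ≫ (monodromy X (Y ⊗ Yᘁ)).hom) ▷ Y ⊗≫ (X ⊗ Y) ◁ ε_ Y Yᘁ ⊗≫ 𝟙 _ := by
      rw [whisker_exchange, monodromy_tensor_right]
      monoidal
    _ = 𝟙 _ ⊗≫ X ◁ (η_ Y Yᘁ ▷ Y ⊗≫ Y ◁ ε_ Y Yᘁ) ⊗≫ 𝟙 _ := by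
      rw [monodromy_naturality_right, monodromy_unit_right]
      monoidal
    _ = _ := by
      rw [ExactPairing.evaluation_coevaluation'']
      monoidal

end Pairing

/-! ### Naturality of `fam` and `act`. -/

section Naturality

variable {C : Type*} [Category C] [MonoidalCategory C] [BraidedCategory C] [RightRigidCategory C]
  {c : Cowedge (dualTensor C)}

theorem fam_whiskerRight_comp {W Z : C} {a : c.pt ⟶ c.pt} {X : C} {t : X ⟶ X}
    (h : coact c X ≫ X ◁ a = t ≫ coact c X) (f : c.pt ⊗ W ⟶ Z) :
    fam c (a ▷ W ≫ f) X = t ▷ W ≫ fam c f X := by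
  calc
    _ = (coact c X ≫ X ◁ a) ▷ W ≫ (α_ X c.pt W).hom ≫ X ◁ f := by
      rw [fam]
      monoidal
    _ = _ := by
      rw [h, fam]
      monoidal

theorem whiskerRight_comp_act {B B' Z : C} (a : B' ⟶ B) (f : B ⊗ c.pt ⟶ Z) (Y : C) :
    a ▷ Y ≫ act f Y = act (a ▷ c.pt ≫ f) Y := by
  calc
    _ = (a ▷ Y ≫ B ◁ coact c Y) ⊗≫ (β_ B Y).hom ▷ c.pt ⊗≫ Y ◁ f := by
      rw [act]
      monoidal
    _ = 𝟙 _ ⊗≫ B' ◁ coact c Y ⊗≫ (a ▷ Y ≫ (β_ B Y).hom) ▷ c.pt ⊗≫ Y ◁ f := by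
      rw [← whisker_exchange]
      monoidal
    _ = _ := by
      rw [BraidedCategory.braiding_naturality_left, act]
      monoidal

theorem act_comp {B Z Z' : C} (f : B ⊗ c.pt ⟶ Z) (g : Z ⟶ Z') (Y : C) :
    act (f ≫ g) Y = act f Y ≫ Y ◁ g := by
  simp [act]

theorem act_whiskerLeft_comp {B Z : C} {a : c.pt ⟶ c.pt} {Y : C} {t : Y ⟶ Y}
    (h : coact c Y ≫ Y ◁ a = t ≫ coact c Y) (f : B ⊗ c.pt ⟶ Z) :
    act (B ◁ a ≫ f) Y = B ◁ t ≫ act f Y := by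
  calc
    _ = 𝟙 _ ⊗≫ B ◁ coact c Y ⊗≫ ((β_ B Y).hom ▷ c.pt ≫ (Y ⊗ B) ◁ a) ⊗≫ Y ◁ f := by
      rw [act]
      monoidal
    _ = 𝟙 _ ⊗≫ B ◁ (coact c Y ≫ Y ◁ a) ⊗≫ (β_ B Y).hom ▷ c.pt ⊗≫ Y ◁ f := by
      rw [← whisker_exchange]
      monoidal
    _ = _ := by
      rw [h, act]
      monoidal

theorem act_unit {Z : C} (f : 𝟙_ C ⊗ c.pt ⟶ Z) (Y : C) :
    act f Y = (λ_ Y).hom ≫ coact c Y ≫ Y ◁ ((λ_ c.pt).inv ≫ f) := by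
  rw [act, braiding_tensorUnit_left]
  monoidal

theorem fam_act_mul_comp (hc : IsCoend c) {Z : C} (g : c.pt ⟶ Z) (X Y : C) :
    fam c (act (mul hc ≫ g) Y) X = coact c (X ⊗ Y) ≫ (X ⊗ Y) ◁ g ≫ (α_ X Y Z).hom := by
  rw [act_comp, fam_comp, coact_tensor hc]
  simp

theorem coact_ext (hc : IsCoend c) {Z : C} {f g : c.pt ⟶ Z}
    (h : ∀ X, coact c X ≫ X ◁ f = coact c X ≫ X ◁ g) : f = g := by
  have key : ∀ (X : C) (f : c.pt ⟶ Z), incl c X ≫ f = (Xᘁ : C) ◁ (coact c X ≫ X ◁ f) ≫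
      (α_ Xᘁ X Z).inv ≫ ε_ X Xᘁ ▷ Z ≫ (λ_ Z).hom := by
    intro X f
    calc
      _ = 𝟙 _ ⊗≫ (Xᘁ : C) ◁ coact c X ⊗≫ (ε_ X Xᘁ ▷ c.pt ≫ 𝟙_ C ◁ f) ⊗≫ 𝟙 _ := by
        rw [incl_eq]
        monoidal
      _ = _ := by
        rw [← whisker_exchange]
        monoidal
  apply coend_hom_ext hc
  intro X
  rw [key, key, h]

end Naturality

/-! ### Functionals on the coend as natural endomorphisms of the identity; cointegrals. -/

section Endo

variable {C : Type*} [Category C] [MonoidalCategory C] [BraidedCategory C] [RightRigidCategory C]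
  {c : Cowedge (dualTensor C)}

/-- The natural endomorphism of the identity functor corresponding to a functional `A ⟶ 𝟙`. -/
def endo (x : c.pt ⟶ 𝟙_ C) (X : C) : X ⟶ X :=
  coact c X ≫ X ◁ x ≫ (ρ_ X).hom

theorem endo_naturality (x : c.pt ⟶ 𝟙_ C) {X Y : C} (f : X ⟶ Y) :
    f ≫ endo x Y = endo x X ≫ f := by
  simp only [endo, Category.assoc]
  rw [reassoc_of% coact_naturality, ← whisker_exchange_assoc, rightUnitor_naturality]

/-- The hypothesis says that the coaction is trivial on the image of `endo x`. By coassociativity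
the two cointegral conditions concern `endo x` applied after and before the coaction; these agree
because the coaction is natural, so one hypothesis gives both. -/
theorem isCointegral_of_endo (hc : IsCoend c) {x : c.pt ⟶ 𝟙_ C}
    (h : ∀ X, endo x X ≫ coact c X = endo x X ≫ (ρ_ X).inv ≫ X ◁ unit c) :
    IsCointegral hc x := by
  have hr : ∀ X, endo x X ≫ (ρ_ X).inv ≫ X ◁ unit c = coact c X ≫ X ◁ (x ≫ unit c) := by
    intro X
    simp [endo]
  constructor
  · apply coact_ext hc
    intro X
    rw [← hr, ← h, coact_naturality, whiskerLeft_comp, reassoc_of% coact_comul, endo]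
    monoidal
  · apply coact_ext hc
    intro X
    rw [← hr, ← h, whiskerLeft_comp, reassoc_of% coact_comul]
    calc
      _ = 𝟙 _ ⊗≫ coact c X ≫ (coact c X ▷ c.pt ≫ (X ⊗ c.pt) ◁ x) ⊗≫ 𝟙 _ := by monoidal
      _ = _ := by
        rw [← whisker_exchange, endo]
        monoidal

theorem endo_comp_coact (hc : IsCoend c) {x : c.pt ⟶ 𝟙_ C} (hx : IsCointegral hc x) (X : C) :
    endo x X ≫ coact c X = endo x X ≫ (ρ_ X).inv ≫ X ◁ unit c := by
  have hr : endo x X ≫ (ρ_ X).inv ≫ X ◁ unit c = coact c X ≫ X ◁ (x ≫ unit c) := by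
    simp [endo]
  rw [hr, ← hx.right, coact_naturality, whiskerLeft_comp, reassoc_of% coact_comul, endo]
  monoidal

theorem hopfPairing_unit_left (hc : IsCoend c) :
    (λ_ c.pt).inv ≫ unit c ▷ c.pt ≫ hopfPairing hc = counit hc := by
  apply coend_hom_ext hc
  intro Y
  have h := whiskerLeft_incl_fam_hopfPairing hc (𝟙_ C) Y
  rw [monodromy_unit_left, fam, coact_unit] at h
  rw [incl_counit]
  calc
    _ = (λ_ _).inv ≫ (𝟙_ C ◁ incl c Y ≫ ((λ_ (𝟙_ C)).inv ≫ 𝟙_ C ◁ unit c) ▷ c.pt ≫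
      (α_ (𝟙_ C) c.pt c.pt).hom ≫ 𝟙_ C ◁ hopfPairing hc) ≫ (λ_ _).hom := by monoidal
    _ = _ := by
      rw [h]
      monoidal

theorem hopfPairing_unit_right (hc : IsCoend c) :
    (ρ_ c.pt).inv ≫ c.pt ◁ unit c ≫ hopfPairing hc = counit hc := by
  have h : act (hopfPairing hc) (𝟙_ C) = counit hc ▷ 𝟙_ C := by
    apply fam_ext hc
    intro X
    rw [fam_act_hopfPairing]
    have h' : (monodromy X (𝟙_ C)).inv = 𝟙 _ := by
      rw [← cancel_epi (monodromy X (𝟙_ C)).hom, Iso.hom_inv_id, monodromy_unit_right,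
        Category.comp_id]
    have h'' := coact_counit hc X
    calc
      _ = 𝟙 _ ⊗≫ (ρ_ X).inv ▷ (𝟙_ C) ⊗≫ 𝟙 _ := by
        rw [h']
        monoidal
      _ = _ := by
        rw [← h'', fam]
        monoidal
  rw [act, coact_unit, braiding_tensorUnit_right] at h
  calc
    _ = (ρ_ _).inv ≫ (c.pt ◁ ((λ_ (𝟙_ C)).inv ≫ 𝟙_ C ◁ unit c) ≫ (α_ c.pt (𝟙_ C) c.pt).inv ≫
      ((ρ_ c.pt).hom ≫ (λ_ c.pt).inv) ▷ c.pt ≫ (α_ (𝟙_ C) c.pt c.pt).hom ≫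
        𝟙_ C ◁ hopfPairing hc) ≫ (λ_ _).hom := by monoidal
    _ = _ := by
      rw [h]
      monoidal

end Endo

/-! ### Cancellation for non-degenerate pairings. -/

section Nondegenerate

variable {C : Type*} [Category C] [MonoidalCategory C] [BraidedCategory C] [RightRigidCategory C]

/-- The morphism `A ⟶ A*` induced by a pairing. -/
def pairingHom {A : C} (p : A ⊗ A ⟶ 𝟙_ C) : A ⟶ Aᘁ :=
  (ρ_ A).inv ≫ A ◁ η_ A Aᘁ ≫ (α_ A A Aᘁ).inv ≫ p ▷ Aᘁ ≫ (λ_ Aᘁ).hom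

theorem pairingHom_evaluation {A : C} (p : A ⊗ A ⟶ 𝟙_ C) :
    pairingHom p ▷ A ≫ ε_ A Aᘁ = p := by
  calc
    _ = 𝟙 _ ⊗≫ A ◁ η_ A Aᘁ ▷ A ⊗≫ (p ▷ (Aᘁ ⊗ A) ≫ 𝟙_ C ◁ ε_ A Aᘁ) ⊗≫ 𝟙 _ := by
      rw [pairingHom]
      monoidal
    _ = 𝟙 _ ⊗≫ A ◁ (η_ A Aᘁ ▷ A ⊗≫ A ◁ ε_ A Aᘁ) ⊗≫ p ⊗≫ 𝟙 _ := by
      rw [← whisker_exchange]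
      monoidal
    _ = _ := by
      rw [ExactPairing.evaluation_coevaluation'']
      monoidal

theorem IsNondegenerate.ext_left {A : C} {p : A ⊗ A ⟶ 𝟙_ C} (hp : IsNondegenerate p) {B X : C}
    {f g : B ⟶ X ⊗ A} (h : f ▷ A ≫ (α_ X A A).hom ≫ X ◁ p = g ▷ A ≫ (α_ X A A).hom ≫ X ◁ p) :
    f = g := by
  have : IsIso (pairingHom p) := hp
  have key : ∀ f : B ⟶ X ⊗ A, (ρ_ B).inv ≫ B ◁ η_ A Aᘁ ≫ (α_ B A Aᘁ).inv ≫
      (f ▷ A ≫ (α_ X A A).hom ≫ X ◁ p) ▷ Aᘁ ≫ (α_ X (𝟙_ C) Aᘁ).hom ≫ X ◁ (λ_ Aᘁ).hom =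
      f ≫ X ◁ pairingHom p := by
    intro f
    calc
      _ = 𝟙 _ ⊗≫ (B ◁ η_ A Aᘁ ≫ f ▷ (A ⊗ Aᘁ)) ⊗≫ X ◁ p ▷ Aᘁ ⊗≫ 𝟙 _ := by monoidal
      _ = _ := by
        rw [whisker_exchange, pairingHom]
        monoidal
  rw [← cancel_mono (X ◁ pairingHom p), ← key, h, key]

/-- Inserting the inverse of `pairingHom p` in the left argument turns `p` into the evaluation; the
zigzag identity then recovers `f`. -/
theorem IsNondegenerate.ext_right {A : C} {p : A ⊗ A ⟶ 𝟙_ C} (hp : IsNondegenerate p) {B X : C}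
    {f g : B ⟶ X ⊗ A}
    (h : A ◁ f ≫ (α_ A X A).inv ≫ (β_ A X).hom ▷ A ≫ (α_ X A A).hom ≫ X ◁ p =
      A ◁ g ≫ (α_ A X A).inv ≫ (β_ A X).hom ▷ A ≫ (α_ X A A).hom ≫ X ◁ p) :
    f = g := by
  have : IsIso (pairingHom p) := hp
  have key : ∀ f : B ⟶ X ⊗ A, (λ_ B).inv ≫ η_ A Aᘁ ▷ B ≫ (α_ A Aᘁ B).hom ≫
      A ◁ (inv (pairingHom p) ▷ B ≫ A ◁ f ≫ (α_ A X A).inv ≫ (β_ A X).hom ▷ A ≫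
        (α_ X A A).hom ≫ X ◁ p) ≫ A ◁ (ρ_ X).hom ≫ (β_ A X).hom = f := by
    intro f
    have h₁ : inv (pairingHom p) ▷ B ≫ A ◁ f ≫ (α_ A X A).inv ≫ (β_ A X).hom ▷ A ≫
        (α_ X A A).hom ≫ X ◁ p = (Aᘁ : C) ◁ f ≫ (α_ Aᘁ X A).inv ≫ (β_ Aᘁ X).hom ▷ A ≫
        (α_ X Aᘁ A).hom ≫ X ◁ ε_ A Aᘁ := by
      rw [← cancel_epi (pairingHom p ▷ B), ← comp_whiskerRight_assoc, IsIso.hom_inv_id,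
        id_whiskerRight, Category.id_comp, ← whisker_exchange_assoc,
        associator_inv_naturality_left_assoc, ← comp_whiskerRight_assoc,
        BraidedCategory.braiding_naturality_left]
      nth_rw 1 [← pairingHom_evaluation p]
      simp
    rw [h₁]
    calc
      _ = 𝟙 _ ⊗≫ (η_ A Aᘁ ▷ B ≫ (A ⊗ Aᘁ) ◁ f) ⊗≫ A ◁ (β_ Aᘁ X).hom ▷ A ⊗≫
        ((A ⊗ X) ◁ ε_ A Aᘁ ≫ (β_ A X).hom ▷ 𝟙_ C) ⊗≫ 𝟙 _ := by monoidal
      _ = f ⊗≫ (η_ A Aᘁ ▷ X ≫ (β_ (A ⊗ Aᘁ) X).hom) ▷ A ⊗≫ X ◁ A ◁ ε_ A Aᘁ ⊗≫ 𝟙 _ := by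
        rw [← whisker_exchange, whisker_exchange (β_ A X).hom (ε_ A Aᘁ),
          BraidedCategory.braiding_tensor_left_hom]
        monoidal
      _ = f ⊗≫ X ◁ (η_ A Aᘁ ▷ A ⊗≫ A ◁ ε_ A Aᘁ) ⊗≫ 𝟙 _ := by
        rw [BraidedCategory.braiding_naturality_left, braiding_tensorUnit_left]
        monoidal
      _ = _ := by
        rw [ExactPairing.evaluation_coevaluation'']
        monoidal
  rw [← key f, h, key]

end Nondegenerate

/-! ### The Hopf pairing in terms of the T-transformation. -/

section Twist

variable {C : Type*} [Category C] [MonoidalCategory C] [BraidedCategory C] [RightRigidCategory C]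
  [RibbonCategory C] {c : Cowedge (dualTensor C)}

/-- The hypothesis amounts to `t = t ∘ t`, and `t` is invertible. -/
theorem eq_id_of_tensorHom_comp_leftUnitor {t : 𝟙_ C ⟶ 𝟙_ C} [IsIso t]
    (h : (λ_ (𝟙_ C)).hom ≫ t = (t ⊗ₘ t) ≫ (λ_ (𝟙_ C)).hom) : t = 𝟙 _ := by
  rw [tensorHom_def', Category.assoc, ← leftUnitor_naturality, cancel_epi, unitors_equal,
    rightUnitor_naturality] at h
  rw [← cancel_epi (ρ_ (𝟙_ C)).hom, ← h, Category.comp_id]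

theorem twist_unit : (twist (C := C)).hom.app (𝟙_ C) = 𝟙 (𝟙_ C) := by
  have hm : (β_ (𝟙_ C) (𝟙_ C)).hom ≫ (β_ (𝟙_ C) (𝟙_ C)).hom = 𝟙 _ := monodromy_unit_left (𝟙_ C)
  have ht : (twist (C := C)).hom.app (𝟙_ C ⊗ 𝟙_ C) =
      (twist (C := C)).hom.app (𝟙_ C) ⊗ₘ (twist (C := C)).hom.app (𝟙_ C) :=
    (twist_tensor _ _).trans ((congrArg (_ ≫ ·) hm).trans (Category.comp_id _))
  exact eq_id_of_tensorHom_comp_leftUnitor (((twist (C := C)).hom.naturality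
    (λ_ (𝟙_ C)).hom).trans (congrArg (· ≫ (λ_ (𝟙_ C)).hom) ht))

theorem twist_inv_unit : (twist (C := C)).inv.app (𝟙_ C) = 𝟙 (𝟙_ C) := by
  have h := (twist (C := C)).hom_inv_id_app (𝟙_ C)
  rw [twist_unit] at h
  simpa using h

theorem monodromy_comp_whisker {X Y : C} (s : X ⟶ X) (t : Y ⟶ Y) :
    (monodromy X Y).hom ≫ s ▷ Y ≫ X ◁ t = s ▷ Y ≫ X ◁ t ≫ (monodromy X Y).hom := by
  rw [← reassoc_of% monodromy_naturality_left, ← monodromy_naturality_right]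

/-- The Hopf pairing is expressed by the product, the counit and the T-transformation. -/
theorem hopfPairing_eq (hc : IsCoend c) :
    hopfPairing hc = (tTransformation hc).hom ▷ c.pt ≫ c.pt ◁ (tTransformation hc).hom ≫
      mul hc ≫ (tTransformation hc).inv ≫ counit hc := by
  apply act_ext hc
  intro Y
  apply fam_ext hc
  intro X
  rw [fam_act_hopfPairing, ← whiskerRight_comp_act,
    fam_whiskerRight_comp (coact_tTransformation_hom hc X),
    act_whiskerLeft_comp (coact_tTransformation_hom hc Y), fam_whiskerLeft_comp,
    fam_act_mul_comp hc, whiskerLeft_comp, Category.assoc,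
    reassoc_of% (coact_tTransformation_inv hc (X ⊗ Y)),
    reassoc_of% (coact_counit hc (X ⊗ Y)),
    ← cancel_epi (monodromy X Y).hom, Iso.hom_inv_id_assoc]
  -- In terms of families the claim is `monodromy⁻¹ = θ_{X ⊗ Y}⁻¹ ∘ (θ_X ⊗ θ_Y)`, which is the
  -- balancing axiom.
  have h : (monodromy X Y).hom ≫ twist.hom.app X ▷ Y ≫ X ◁ twist.hom.app Y =
      twist.hom.app (X ⊗ Y) :=
    (monodromy_comp_whisker (twist.hom.app X) (twist.hom.app Y)).trans (by
      rw [twist_tensor, MonoidalCategory.tensorHom_def, Category.assoc]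
      rfl)
  rw [reassoc_of% h, ← NatTrans.comp_app_assoc, Iso.hom_inv_id, NatTrans.id_app]
  simp

end Twist

/-! ### Integrals: the product of the stabilization coefficients, and the left pairing. -/

section Integral

variable {C : Type*} [Category C] [MonoidalCategory C] [BraidedCategory C] [RightRigidCategory C]
  {c : Cowedge (dualTensor C)}

/-- The inverse twist acts on `X` through the coaction, by the functional `ε ∘ T⁻¹`. The image of
`endo x` has trivial coaction, so the twist acts there by `ε ∘ T⁻¹ ∘ η`, which is the identity since
the twist of `𝟙` is trivial. -/
theorem tTransformation_inv_comp_cointegral [RibbonCategory C] (hc : IsCoend c)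
    {x : c.pt ⟶ 𝟙_ C} (hx : IsCointegral hc x) : (tTransformation hc).inv ≫ x = x := by
  have hu : unit c ≫ (tTransformation hc).inv ≫ counit hc = 𝟙 _ := by
    have h : coact c (𝟙_ C) ≫ 𝟙_ C ◁ (tTransformation hc).inv = coact c (𝟙_ C) :=
      (coact_tTransformation_inv hc (𝟙_ C)).trans (by
        rw [twist_inv_unit]
        exact Category.id_comp _)
    have h' := coact_counit hc (𝟙_ C)
    rw [← h, coact_unit] at h'
    rw [← cancel_epi (λ_ (𝟙_ C)).hom, ← leftUnitor_naturality, Category.comp_id,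
      ← cancel_epi (λ_ (𝟙_ C)).inv]
    simp only [Category.assoc] at h'
    simp only [whiskerLeft_comp, Category.assoc]
    rw [reassoc_of% h', unitors_equal, unitors_inv_equal]
  have hθ : ∀ X, twist.inv.app X ≫ endo x X = endo x X := by
    intro X
    have h := congrArg (· ≫ X ◁ ((tTransformation hc).inv ≫ counit hc) ≫ (ρ_ X).hom)
      (endo_comp_coact hc hx X)
    simp only [Category.assoc, ← whiskerLeft_comp_assoc, hu, whiskerLeft_id, Category.id_comp,
      Iso.inv_hom_id, Category.comp_id] at h
    rw [whiskerLeft_comp, Category.assoc, reassoc_of% (coact_tTransformation_inv hc X),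
      reassoc_of% (coact_counit hc X), Iso.inv_hom_id, Category.comp_id] at h
    exact (endo_naturality x (twist.inv.app X)).trans h
  apply coact_ext hc
  intro X
  rw [whiskerLeft_comp, reassoc_of% (coact_tTransformation_inv hc X),
    ← cancel_mono (ρ_ X).hom]
  simpa only [Category.assoc, endo] using hθ X

theorem whiskerRight_comp_mul (hc : IsCoend c) {Λ : 𝟙_ C ⟶ c.pt} (hΛ : IsRightIntegral hc Λ) :
    Λ ▷ c.pt ≫ mul hc = (λ_ c.pt).hom ≫ counit hc ≫ Λ := by
  rw [← Iso.inv_comp_eq, hΛ]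

/-- The functional `ω ∘ (Λ ⊗ id)` associated with `Λ`. -/
def pairingLeft (hc : IsCoend c) (Λ : 𝟙_ C ⟶ c.pt) : c.pt ⟶ 𝟙_ C :=
  (λ_ c.pt).inv ≫ Λ ▷ c.pt ≫ hopfPairing hc

/-- The functional `ω ∘ (id ⊗ Λ)` associated with `Λ`. -/
def pairingRight (hc : IsCoend c) (Λ : 𝟙_ C ⟶ c.pt) : c.pt ⟶ 𝟙_ C :=
  (ρ_ c.pt).inv ≫ c.pt ◁ Λ ≫ hopfPairing hc

theorem comp_pairingRight (hc : IsCoend c) (Λ Λ' : 𝟙_ C ⟶ c.pt) :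
    Λ' ≫ pairingRight hc Λ = Λ ≫ pairingLeft hc Λ' := by
  rw [pairingRight, pairingLeft, rightUnitor_inv_naturality_assoc,
    leftUnitor_inv_naturality_assoc, ← whisker_exchange_assoc, unitors_inv_equal]

/-- The product of the two stabilization coefficients of an integral. -/
theorem comp_pairingLeft_self [RibbonCategory C] (hc : IsCoend c) {Λ : 𝟙_ C ⟶ c.pt}
    (hΛ : IsRightIntegral hc Λ) (h : IsCointegral hc (pairingRight hc Λ)) :
    Λ ≫ pairingLeft hc Λ = (Λ ≫ (tTransformation hc).hom ≫ counit hc) ≫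
      Λ ≫ (tTransformation hc).inv ≫ counit hc := by
  -- A `T⁻¹` is inserted in the first argument of `ω(Λ, Λ)`; it cancels the first `T` of
  -- `hopfPairing_eq`.
  rw [← comp_pairingRight, ← tTransformation_inv_comp_cointegral hc h, pairingRight,
    rightUnitor_inv_naturality_assoc, rightUnitor_inv_naturality_assoc,
    ← whisker_exchange_assoc, ← whisker_exchange_assoc, hopfPairing_eq,
    ← comp_whiskerRight_assoc (tTransformation hc).inv (tTransformation hc).hom, Iso.inv_hom_id, id_whiskerRight, Category.id_comp,
    whisker_exchange_assoc, ← whiskerLeft_comp_assoc, ← whisker_exchange_assoc]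
  -- The integral property splits `μ(Λ, TΛ)` as `ε(TΛ) Λ`.
  rw [reassoc_of% (whiskerRight_comp_mul hc hΛ), leftUnitor_naturality_assoc, unitors_equal,
    Iso.inv_hom_id_assoc]
  simp

theorem leftUnitor_inv_comp_act (hc : IsCoend c) (Λ : 𝟙_ C ⟶ c.pt) (Y : C) :
    (λ_ Y).inv ≫ Λ ▷ Y ≫ act (hopfPairing hc) Y = endo (pairingLeft hc Λ) Y ≫ (ρ_ Y).inv := by
  rw [whiskerRight_comp_act, act_unit, endo, pairingLeft]
  simp

theorem isCointegral_pairingLeft (hc : IsCoend c) (hω : IsNondegenerate (hopfPairing hc))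
    {Λ : 𝟙_ C ⟶ c.pt} (hΛ : IsRightIntegral hc Λ) : IsCointegral hc (pairingLeft hc Λ) := by
  -- Compatibility of `ω` with the product in its first argument. As families in `V`, the left side
  -- is the inverse double braiding of `V ⊗ X` with `Y`, and the right side is its hexagon
  -- decomposition.
  have h₁ : ∀ X Y : C, (α_ c.pt X Y).inv ≫ act (mul hc) X ▷ Y ≫ (α_ X c.pt Y).hom ≫
      X ◁ (act (hopfPairing hc) Y ≫ (ρ_ Y).hom) =
      c.pt ◁ (β_ Y X).inv ≫ (α_ c.pt Y X).inv ≫ (act (hopfPairing hc) Y ≫ (ρ_ Y).hom) ▷ X ≫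
        (β_ X Y).inv := by
    intro X Y
    apply fam_ext hc
    intro V
    have hl : fam c ((α_ c.pt X Y).inv ≫ act (mul hc) X ▷ Y ≫ (α_ X c.pt Y).hom ≫
        X ◁ (act (hopfPairing hc) Y ≫ (ρ_ Y).hom)) V =
        (α_ V X Y).inv ≫ (monodromy (V ⊗ X) Y).inv ≫ (α_ V X Y).hom := by
      calc
        _ = (α_ V X Y).inv ≫ (fam c (act (mul hc) X) V ≫ (α_ V X c.pt).inv) ▷ Y ⊗≫
            (V ⊗ X) ◁ (act (hopfPairing hc) Y ≫ (ρ_ Y).hom) ≫ (α_ V X Y).hom := by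
          simp only [fam]
          monoidal
        _ = (α_ V X Y).inv ≫ fam c (act (hopfPairing hc) Y) (V ⊗ X) ≫ (V ⊗ X) ◁ (ρ_ Y).hom ≫
            (α_ V X Y).hom := by
          rw [← coact_tensor hc, fam]
          monoidal
        _ = _ := by
          rw [fam_act_hopfPairing]
          simp
    have hr : fam c (c.pt ◁ (β_ Y X).inv ≫ (α_ c.pt Y X).inv ≫
        (act (hopfPairing hc) Y ≫ (ρ_ Y).hom) ▷ X ≫ (β_ X Y).inv) V =
        V ◁ (β_ Y X).inv ≫ (α_ V Y X).inv ≫ (monodromy V Y).inv ▷ X ≫ (α_ V Y X).hom ≫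
          V ◁ (β_ X Y).inv := by
      calc
        _ = V ◁ (β_ Y X).inv ≫ (α_ V Y X).inv ≫ fam c (act (hopfPairing hc) Y) V ▷ X ⊗≫
            V ◁ (β_ X Y).inv := by
          rw [fam_whiskerLeft_comp, fam, fam]
          monoidal
        _ = _ := by
          rw [fam_act_hopfPairing]
          monoidal
    rw [hl, hr, ← cancel_mono (V ◁ (β_ X Y).hom), ← cancel_mono (α_ V Y X).inv,
      ← cancel_mono ((monodromy V Y).hom ▷ X), ← cancel_mono (α_ V Y X).hom,
      ← cancel_mono (V ◁ (β_ Y X).hom), ← cancel_mono (α_ V X Y).inv]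
    have := monodromy_tensor_left V X Y
    simp only [Category.assoc]
    rw [← this]
    simp [← comp_whiskerRight_assoc, ← whiskerLeft_comp_assoc]
  -- Evaluating `h₁` at `Λ`, where the product collapses to the counit, shows that the image of the
  -- endomorphism is transparent: its double braiding with every `X` is trivial.
  have h₂ : ∀ X Y : C, X ◁ endo (pairingLeft hc Λ) Y ≫ (monodromy X Y).inv =
      X ◁ endo (pairingLeft hc Λ) Y := by
    intro X Y
    have hg : (λ_ Y).inv ≫ Λ ▷ Y ≫ act (hopfPairing hc) Y ≫ (ρ_ Y).hom =
        endo (pairingLeft hc Λ) Y := by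
      rw [reassoc_of% (leftUnitor_inv_comp_act hc Λ Y)]
      simp
    have hm : Λ ▷ X ≫ act (mul hc) X = (λ_ X).hom ≫ (ρ_ X).inv ≫ X ◁ Λ := by
      rw [whiskerRight_comp_act, whiskerRight_comp_mul hc hΛ, act_unit, Iso.inv_hom_id_assoc,
        whiskerLeft_comp, reassoc_of% (coact_counit hc X)]
    have h := congrArg (fun t => (λ_ (X ⊗ Y)).inv ≫ Λ ▷ (X ⊗ Y) ≫ t) (h₁ X Y)
    have hl : (λ_ (X ⊗ Y)).inv ≫ Λ ▷ (X ⊗ Y) ≫ (α_ c.pt X Y).inv ≫ act (mul hc) X ▷ Y ≫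
        (α_ X c.pt Y).hom ≫ X ◁ (act (hopfPairing hc) Y ≫ (ρ_ Y).hom) =
        X ◁ endo (pairingLeft hc Λ) Y := by
      calc
        _ = (λ_ (X ⊗ Y)).inv ⊗≫ (Λ ▷ X ≫ act (mul hc) X) ▷ Y ⊗≫
            X ◁ (act (hopfPairing hc) Y ≫ (ρ_ Y).hom) := by monoidal
        _ = X ◁ ((λ_ Y).inv ≫ Λ ▷ Y ≫ act (hopfPairing hc) Y ≫ (ρ_ Y).hom) := by
          rw [hm]
          monoidal
        _ = _ := by rw [hg]
    have hr : (λ_ (X ⊗ Y)).inv ≫ Λ ▷ (X ⊗ Y) ≫ c.pt ◁ (β_ Y X).inv ≫ (α_ c.pt Y X).inv ≫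
        (act (hopfPairing hc) Y ≫ (ρ_ Y).hom) ▷ X ≫ (β_ X Y).inv =
        (β_ Y X).inv ≫ endo (pairingLeft hc Λ) Y ▷ X ≫ (β_ X Y).inv := by
      rw [← whisker_exchange_assoc, ← hg]
      monoidal
    rw [hl, hr, ← BraidedCategory.braiding_inv_naturality_right_assoc] at h
    simp only [monodromy, Iso.trans_inv]
    exact h.symm
  apply isCointegral_of_endo
  intro Y
  apply hω.ext_right
  -- Transparency rewritten as a statement about `ω`: on this image the pairing with the coaction is
  -- the counit, that is, the pairing with the unit. Non-degeneracy then makes the coaction trivial.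
  have h₃ : c.pt ◁ endo (pairingLeft hc Λ) Y ≫ act (hopfPairing hc) Y =
      counit hc ▷ Y ≫ (λ_ Y).hom ≫ endo (pairingLeft hc Λ) Y ≫ (ρ_ Y).inv := by
    apply fam_ext hc
    intro X
    rw [fam_whiskerLeft_comp, fam_act_hopfPairing, reassoc_of% (h₂ X Y)]
    calc
      _ = (ρ_ X).inv ▷ Y ⊗≫ X ◁ (endo (pairingLeft hc Λ) Y ≫ (ρ_ Y).inv) := by monoidal
      _ = _ := by
        rw [← coact_counit hc X, fam]
        monoidal
  calc
    _ = c.pt ◁ endo (pairingLeft hc Λ) Y ≫ act (hopfPairing hc) Y := by simp [act]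
    _ = 𝟙 _ ⊗≫ (counit hc ▷ Y ≫ 𝟙_ C ◁ endo (pairingLeft hc Λ) Y) ⊗≫ 𝟙 _ := by
      rw [h₃]
      monoidal
    _ = c.pt ◁ endo (pairingLeft hc Λ) Y ⊗≫ (counit hc ▷ Y ≫ (β_ (𝟙_ C) Y).hom) ⊗≫ 𝟙 _ := by
      rw [← whisker_exchange, braiding_tensorUnit_left]
      monoidal
    _ = c.pt ◁ endo (pairingLeft hc Λ) Y ⊗≫ ((β_ c.pt Y).hom ▷ 𝟙_ C ≫ (Y ⊗ c.pt) ◁ unit c) ⊗≫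
        Y ◁ hopfPairing hc := by
      rw [BraidedCategory.braiding_naturality_left, ← hopfPairing_unit_right]
      monoidal
    _ = _ := by
      rw [← whisker_exchange]
      monoidal

end Integral

/-! ### The right pairing with an integral. -/

section RightPairing

variable {C : Type*} [Category C] [MonoidalCategory C] [BraidedCategory C] [RightRigidCategory C]
  {c : Cowedge (dualTensor C)}

theorem whiskerLeft_incl_ext (hc : IsCoend c) {B Z : C} {f g : B ⊗ c.pt ⟶ Z}
    (h : ∀ Y, B ◁ incl c Y ≫ f = B ◁ incl c Y ≫ g) : f = g := by
  rw [← cancel_epi (β_ B c.pt).inv]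
  apply tensor_coend_hom_ext hc
  intro X
  rw [BraidedCategory.braiding_inv_naturality_left_assoc,
    BraidedCategory.braiding_inv_naturality_left_assoc, h]

theorem whiskerLeft_incl_whiskerRight_ext (hc : IsCoend c) {B W Z : C}
    {f g : (B ⊗ c.pt) ⊗ W ⟶ Z}
    (h : ∀ Y, (B ◁ incl c Y) ▷ W ≫ f = (B ◁ incl c Y) ▷ W ≫ g) : f = g := by
  apply (tensorRightHomEquiv _ W (Wᘁ) Z).injective
  apply whiskerLeft_incl_ext hc
  intro X
  apply (tensorRightHomEquiv _ W (Wᘁ) Z).symm.injective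
  simpa only [tensorRightHomEquiv_symm_naturality, Equiv.symm_apply_apply] using h X

/-- The right action `X ⊗ A ⟶ X` of the coend on an object, induced by the Hopf pairing. -/
def pairingAct (hc : IsCoend c) (X : C) : X ⊗ c.pt ⟶ X :=
  fam c (hopfPairing hc) X ≫ (ρ_ X).hom

/-- The morphism `X ⊗ (Y* ⊗ Y) ⟶ X` which wraps `X` around `Y*` and evaluates on `Y`. -/
def wrap (X Y : C) : X ⊗ (Yᘁ ⊗ Y) ⟶ X :=
  (α_ X Yᘁ Y).inv ≫ (monodromy X (Yᘁ)).hom ▷ Y ≫ (α_ X Yᘁ Y).hom ≫ X ◁ ε_ Y Yᘁ ≫ (ρ_ X).hom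

theorem whiskerLeft_incl_pairingAct (hc : IsCoend c) (X Y : C) :
    X ◁ incl c Y ≫ pairingAct hc X = wrap X Y := by
  rw [pairingAct, reassoc_of% (whiskerLeft_incl_fam_hopfPairing hc X Y), wrap]

/-- By the hexagon, wrapping `X` around `Z* ⊗ Y*` is wrapping around both factors. Evaluating on `Y`
straightens the inner loop, leaving two successive wrappings. This is the associativity of
`pairingAct` before passing to the coend. -/
theorem mergeDual_wrap (X Y Z : C) :
    X ◁ mergeDual Y Z ≫ wrap X (Y ⊗ Z) =
      (α_ X (Yᘁ ⊗ Y) (Zᘁ ⊗ Z)).inv ≫ wrap X Y ▷ (Zᘁ ⊗ Z) ≫ wrap X Z := by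
  calc
    _ = 𝟙 _ ⊗≫ X ◁ (β_ (Yᘁ ⊗ Y) Zᘁ).hom ▷ Z ⊗≫
        (X ◁ (rightDualTensorIso Y Z).inv ≫ (monodromy X ((Y ⊗ Z)ᘁ)).hom) ▷ (Y ⊗ Z) ⊗≫
          X ◁ ε_ (Y ⊗ Z) (Y ⊗ Z)ᘁ ⊗≫ 𝟙 _ := by
      rw [mergeDual, wrap]
      monoidal
    _ = 𝟙 _ ⊗≫ X ◁ (β_ (Yᘁ ⊗ Y) Zᘁ).hom ▷ Z ⊗≫
        (monodromy X (Zᘁ ⊗ Yᘁ)).hom ▷ (Y ⊗ Z) ⊗≫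
          X ◁ ((rightDualTensorIso Y Z).inv ▷ (Y ⊗ Z) ≫ ε_ (Y ⊗ Z) (Y ⊗ Z)ᘁ) ⊗≫ 𝟙 _ := by
      rw [monodromy_naturality_right]
      monoidal
    _ = 𝟙 _ ⊗≫ X ◁ (β_ (Yᘁ ⊗ Y) Zᘁ).hom ▷ Z ⊗≫ (β_ X Zᘁ).hom ▷ (Yᘁ ⊗ Y ⊗ Z) ⊗≫
        (Zᘁ : C) ◁ (monodromy X (Yᘁ)).hom ▷ (Y ⊗ Z) ⊗≫
        ((β_ Zᘁ X).hom ▷ (Yᘁ ⊗ Y) ≫ (X ⊗ Zᘁ) ◁ ε_ Y Yᘁ) ▷ Z ⊗≫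
          X ◁ ε_ Z Zᘁ ⊗≫ 𝟙 _ := by
      rw [dualTensorIso_inv_evaluation, monodromy_tensor_right]
      monoidal
    _ = 𝟙 _ ⊗≫ ((β_ (X ⊗ (Yᘁ ⊗ Y)) Zᘁ).hom ≫ (Zᘁ : C) ◁ wrap X Y) ▷ Z ⊗≫
        (β_ Zᘁ X).hom ▷ Z ⊗≫ X ◁ ε_ Z Zᘁ ⊗≫ 𝟙 _ := by
      rw [← whisker_exchange, BraidedCategory.braiding_tensor_left_hom X (Yᘁ ⊗ Y) Zᘁ, wrap]
      monoidal
    _ = _ := by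
      rw [← BraidedCategory.braiding_naturality_left]
      nth_rw 3 [wrap]
      rw [monodromy, Iso.trans_hom]
      monoidal

theorem pairingAct_mul (hc : IsCoend c) (X : C) :
    X ◁ mul hc ≫ pairingAct hc X =
      (α_ X c.pt c.pt).inv ≫ pairingAct hc X ▷ c.pt ≫ pairingAct hc X := by
  rw [← cancel_epi (α_ X c.pt c.pt).hom]
  apply whiskerLeft_incl_whiskerRight_ext hc
  intro Y
  apply whiskerLeft_incl_ext hc
  intro Z
  calc
    _ = (α_ X (Yᘁ ⊗ Y) (Zᘁ ⊗ Z)).hom ≫ X ◁ ((incl c Y ⊗ₘ incl c Z) ≫ mul hc) ≫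
        pairingAct hc X := by
      rw [tensorHom_def']
      monoidal
    _ = wrap X Y ▷ (Zᘁ ⊗ Z) ≫ wrap X Z := by
      rw [incl_mul, whiskerLeft_comp, Category.assoc, whiskerLeft_incl_pairingAct, mergeDual_wrap]
      simp
    _ = _ := by
      rw [← whiskerLeft_incl_pairingAct hc, ← whiskerLeft_incl_pairingAct hc, comp_whiskerRight,
        Category.assoc, ← whisker_exchange_assoc, ← whisker_exchange_assoc,
        Iso.hom_inv_id_assoc]

theorem isCointegral_pairingRight (hc : IsCoend c) (hω : IsNondegenerate (hopfPairing hc))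
    {Λ : 𝟙_ C ⟶ c.pt} (hΛ : IsRightIntegral hc Λ) : IsCointegral hc (pairingRight hc Λ) := by
  have hk : ∀ X, endo (pairingRight hc Λ) X = (ρ_ X).inv ≫ X ◁ Λ ≫ pairingAct hc X := by
    intro X
    rw [endo, pairingRight, pairingAct, fam]
    calc
      _ = 𝟙 _ ⊗≫ (coact c X ▷ 𝟙_ C ≫ (X ⊗ c.pt) ◁ Λ) ⊗≫ X ◁ hopfPairing hc ⊗≫ 𝟙 _ := by monoidal
      _ = _ := by
        rw [← whisker_exchange]
        monoidal
  -- `endo (pairingRight hc Λ)` is the action of `Λ`, so acting further by `A` goes through `μ ∘ (Λ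
  -- ⊗ id) = Λ ∘ ε`.
  have hm : ∀ X, endo (pairingRight hc Λ) X ▷ c.pt ≫ pairingAct hc X =
      X ◁ counit hc ≫ (ρ_ X).hom ≫ endo (pairingRight hc Λ) X := by
    intro X
    calc
      _ = (ρ_ X).inv ▷ c.pt ⊗≫ X ◁ (Λ ▷ c.pt) ⊗≫ ((α_ X c.pt c.pt).inv ≫
          pairingAct hc X ▷ c.pt ≫ pairingAct hc X) := by
        rw [hk]
        monoidal
      _ = (ρ_ X).inv ▷ c.pt ⊗≫ X ◁ (Λ ▷ c.pt ≫ mul hc) ≫ pairingAct hc X := by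
        rw [← pairingAct_mul]
        monoidal
      _ = _ := by
        rw [whiskerRight_comp_mul hc hΛ, hk]
        monoidal
  apply isCointegral_of_endo
  intro X
  apply hω.ext_left
  calc
    _ = (endo (pairingRight hc Λ) X ▷ c.pt ≫ pairingAct hc X) ≫ (ρ_ X).inv := by
      simp [pairingAct, fam]
    _ = 𝟙 _ ⊗≫ (X ◁ counit hc ≫ endo (pairingRight hc Λ) X ▷ 𝟙_ C) ⊗≫ 𝟙 _ := by
      rw [hm]
      monoidal
    _ = _ := by
      rw [whisker_exchange, ← hopfPairing_unit_left]
      monoidal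

end RightPairing

/-! ### The action `x ∘ μ` of the coend, its colinearity, and an antipode identity. -/

section ProductAction

variable {C : Type*} [Category C] [MonoidalCategory C] [BraidedCategory C] [RightRigidCategory C]
  {c : Cowedge (dualTensor C)}

theorem comul_coassoc (hc : IsCoend c) :
    comul hc ≫ comul hc ▷ c.pt ≫ (α_ c.pt c.pt c.pt).hom = comul hc ≫ c.pt ◁ comul hc := by
  apply coact_ext hc
  intro X
  calc
    _ = coact c X ≫ (coact c X ≫ X ◁ comul hc) ▷ c.pt ⊗≫ 𝟙 _ := by
      rw [whiskerLeft_comp, reassoc_of% coact_comul]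
      monoidal
    _ = (coact c X ≫ coact c X ▷ c.pt ≫ (α_ X c.pt c.pt).hom) ≫
        coact c X ▷ (c.pt ⊗ c.pt) ⊗≫ 𝟙 _ := by
      rw [coact_comul]
      monoidal
    _ = coact c X ≫ (coact c X ▷ c.pt ≫ (X ⊗ c.pt) ◁ comul hc) ⊗≫ 𝟙 _ := by
      rw [← coact_comul hc, ← whisker_exchange]
      monoidal
    _ = _ := by
      rw [whiskerLeft_comp, reassoc_of% coact_comul]
      monoidal

theorem comul_counit (hc : IsCoend c) :
    comul hc ≫ counit hc ▷ c.pt = (λ_ c.pt).inv := by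
  apply coact_ext hc
  intro X
  calc
    _ = coact c X ≫ (coact c X ≫ X ◁ counit hc) ▷ c.pt ⊗≫ 𝟙 _ := by
      rw [whiskerLeft_comp, reassoc_of% coact_comul]
      monoidal
    _ = _ := by
      rw [coact_counit]
      monoidal

theorem unit_whiskerRight_comp_act_mul (hc : IsCoend c) (Y : C) :
    unit c ▷ Y ≫ act (mul hc) Y = (λ_ Y).hom ≫ coact c Y := by
  have h := coact_naturality c (λ_ Y).hom
  rw [coact_tensor hc, fam, coact_unit] at h
  rw [h]
  monoidal

/-- The first factor contributes only the unit of `A` to the coaction on the tensor product, and the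
unit is neutral for `μ`. -/
theorem endo_whiskerRight_comp_coact (hc : IsCoend c) {x : c.pt ⟶ 𝟙_ C} (hx : IsCointegral hc x)
    (U V : C) : endo x U ▷ V ≫ coact c (U ⊗ V) =
      endo x U ▷ V ≫ U ◁ coact c V ≫ (α_ U V c.pt).inv := by
  calc
    _ = (endo x U ≫ coact c U) ▷ V ≫ (α_ U c.pt V).hom ≫ U ◁ act (mul hc) V ≫
        (α_ U V c.pt).inv := by
      rw [coact_tensor hc, fam]
      simp
    _ = endo x U ▷ V ⊗≫ U ◁ (unit c ▷ V ≫ act (mul hc) V) ⊗≫ 𝟙 _ := by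
      rw [endo_comp_coact hc hx]
      monoidal
    _ = _ := by
      rw [unit_whiskerRight_comp_act_mul]
      monoidal

/-- The morphism `A ⊗ V ⟶ V` given by the product followed by a functional `x`. -/
def mulAct (hc : IsCoend c) (x : c.pt ⟶ 𝟙_ C) (V : C) : c.pt ⊗ V ⟶ V :=
  act (mul hc ≫ x) V ≫ (ρ_ V).hom

theorem fam_mulAct (hc : IsCoend c) (x : c.pt ⟶ 𝟙_ C) (U V : C) :
    fam c (mulAct hc x V) U = endo x (U ⊗ V) := by
  rw [mulAct, fam_comp, fam_act_mul_comp, endo]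
  simp

theorem mulAct_naturality (hc : IsCoend c) (x : c.pt ⟶ 𝟙_ C) {V W : C} (f : V ⟶ W) :
    c.pt ◁ f ≫ mulAct hc x W = mulAct hc x V ≫ f := by
  apply fam_ext hc
  intro U
  rw [fam_whiskerLeft_comp, fam_comp, fam_mulAct, fam_mulAct, endo_naturality]

theorem incl_mulAct (hc : IsCoend c) (x : c.pt ⟶ 𝟙_ C) (X V : C) :
    incl c X ▷ V ≫ mulAct hc x V = (α_ Xᘁ X V).hom ≫ (Xᘁ : C) ◁ endo x (X ⊗ V) ≫
      (α_ Xᘁ X V).inv ≫ ε_ X Xᘁ ▷ V ≫ (λ_ V).hom := by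
  rw [incl_whiskerRight_comp, fam_mulAct]

/-- The morphism `A ⟶ V ⊗ V*` corresponding to `mulAct`. -/
def mulActDual (hc : IsCoend c) (x : c.pt ⟶ 𝟙_ C) (V : C) : c.pt ⟶ V ⊗ Vᘁ :=
  (ρ_ c.pt).inv ≫ c.pt ◁ η_ V Vᘁ ≫ (α_ c.pt V Vᘁ).inv ≫ mulAct hc x V ▷ Vᘁ

theorem mulAct_eq (hc : IsCoend c) (x : c.pt ⟶ 𝟙_ C) (V : C) :
    mulAct hc x V = mulActDual hc x V ▷ V ≫ (α_ V Vᘁ V).hom ≫ V ◁ ε_ V Vᘁ ≫ (ρ_ V).hom := by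
  symm
  calc
    _ = 𝟙 _ ⊗≫ c.pt ◁ η_ V Vᘁ ▷ V ⊗≫ (mulAct hc x V ▷ (Vᘁ ⊗ V) ≫ V ◁ ε_ V Vᘁ) ⊗≫ 𝟙 _ := by
      rw [mulActDual]
      monoidal
    _ = 𝟙 _ ⊗≫ c.pt ◁ (η_ V Vᘁ ▷ V ⊗≫ V ◁ ε_ V Vᘁ) ⊗≫ mulAct hc x V := by
      rw [← whisker_exchange]
      monoidal
    _ = _ := by
      rw [ExactPairing.evaluation_coevaluation'']
      monoidal

/-- Colinearity of `mulActDual`. Tested on `U`, this morphism is the bent form of `endo x (U ⊗ V)`,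
so it remains to move the coaction through it: by naturality the coaction passes to `U ⊗ V ⊗ V*`,
where only the factor `V*` contributes. -/
theorem comul_mulActDual (hc : IsCoend c) {x : c.pt ⟶ 𝟙_ C} (hx : IsCointegral hc x) (V : C) :
    comul hc ≫ mulActDual hc x V ▷ c.pt =
      mulActDual hc x V ≫ V ◁ coact c Vᘁ ≫ (α_ V Vᘁ c.pt).inv := by
  apply coact_ext hc
  intro U
  have hG : coact c U ≫ U ◁ mulActDual hc x V = (ρ_ U).inv ≫ U ◁ η_ V Vᘁ ≫ (α_ U V Vᘁ).inv ≫
      endo x (U ⊗ V) ▷ Vᘁ ≫ (α_ U V Vᘁ).hom := by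
    rw [← fam_mulAct hc, mulActDual, fam]
    calc
      _ = 𝟙 _ ⊗≫ (coact c U ▷ 𝟙_ C ≫ (U ⊗ c.pt) ◁ η_ V Vᘁ) ⊗≫ U ◁ mulAct hc x V ▷ Vᘁ := by
        monoidal
      _ = _ := by
        rw [← whisker_exchange]
        monoidal
  calc
    _ = (coact c U ≫ (coact c U ≫ U ◁ mulActDual hc x V) ▷ c.pt) ≫
        (α_ U (V ⊗ Vᘁ) c.pt).hom := by
      rw [whiskerLeft_comp, reassoc_of% coact_comul]
      simp
    _ = (ρ_ U).inv ≫ U ◁ η_ V Vᘁ ≫ (α_ U V Vᘁ).inv ≫ endo x (U ⊗ V) ▷ Vᘁ ≫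
        ((α_ U V Vᘁ).hom ≫ coact c (U ⊗ V ⊗ Vᘁ)) ≫ (α_ U (V ⊗ Vᘁ) c.pt).hom := by
      rw [← coact_naturality, hG]
      simp
    _ = (ρ_ U).inv ≫ U ◁ η_ V Vᘁ ≫ (α_ U V Vᘁ).inv ≫
        (endo x (U ⊗ V) ▷ Vᘁ ≫ coact c ((U ⊗ V) ⊗ Vᘁ)) ≫ (α_ U V Vᘁ).hom ▷ c.pt ≫
          (α_ U (V ⊗ Vᘁ) c.pt).hom := by
      rw [coact_naturality]
      simp
    _ = (coact c U ≫ U ◁ mulActDual hc x V) ⊗≫ U ◁ V ◁ coact c Vᘁ ⊗≫ 𝟙 _ := by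
      rw [endo_whiskerRight_comp_coact hc hx, hG]
      monoidal
    _ = _ := by monoidal

/-- The morphism `A ⊗ (X* ⊗ X) ⊗ Y ⟶ Y` which applies `mulAct` to `X* ⊗ Y` and evaluates. -/
def mulActEval (hc : IsCoend c) (x : c.pt ⟶ 𝟙_ C) (X Y : C) : c.pt ⊗ ((Xᘁ ⊗ X) ⊗ Y) ⟶ Y :=
  c.pt ◁ ((α_ Xᘁ X Y).hom ≫ (Xᘁ : C) ◁ (β_ Y X).inv ≫ (α_ Xᘁ Y X).inv) ≫
    (α_ c.pt (Xᘁ ⊗ Y) X).inv ≫ mulAct hc x (Xᘁ ⊗ Y) ▷ X ≫ (α_ Xᘁ Y X).hom ≫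
      (Xᘁ : C) ◁ (β_ Y X).hom ≫ (α_ Xᘁ X Y).inv ≫ ε_ X Xᘁ ▷ Y ≫ (λ_ Y).hom

theorem mulActEval_dinatural (hc : IsCoend c) (x : c.pt ⟶ 𝟙_ C) {X X' : C} (f : X ⟶ X') (Y : C) :
    c.pt ◁ (fᘁ ▷ X) ▷ Y ≫ mulActEval hc x X Y =
      c.pt ◁ ((X'ᘁ : C) ◁ f) ▷ Y ≫ mulActEval hc x X' Y := by
  calc
    _ = 𝟙 _ ⊗≫ c.pt ◁ (fᘁ ▷ (X ⊗ Y) ≫ (Xᘁ : C) ◁ (β_ Y X).inv) ⊗≫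
        mulAct hc x (Xᘁ ⊗ Y) ▷ X ⊗≫ (Xᘁ : C) ◁ (β_ Y X).hom ⊗≫ ε_ X Xᘁ ▷ Y ⊗≫ 𝟙 _ := by
      rw [mulActEval]
      monoidal
    _ = 𝟙 _ ⊗≫ c.pt ◁ (X'ᘁ : C) ◁ (β_ Y X).inv ⊗≫ (c.pt ◁ fᘁ ▷ Y ≫
        mulAct hc x (Xᘁ ⊗ Y)) ▷ X ⊗≫ (Xᘁ : C) ◁ (β_ Y X).hom ⊗≫ ε_ X Xᘁ ▷ Y ⊗≫ 𝟙 _ := by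
      rw [← whisker_exchange]
      monoidal
    _ = 𝟙 _ ⊗≫ c.pt ◁ (X'ᘁ : C) ◁ (β_ Y X).inv ⊗≫ mulAct hc x (X'ᘁ ⊗ Y) ▷ X ⊗≫
        (fᘁ ▷ (Y ⊗ X) ≫ (Xᘁ : C) ◁ (β_ Y X).hom) ⊗≫ ε_ X Xᘁ ▷ Y ⊗≫ 𝟙 _ := by
      rw [mulAct_naturality]
      monoidal
    _ = 𝟙 _ ⊗≫ c.pt ◁ (X'ᘁ : C) ◁ (β_ Y X).inv ⊗≫ mulAct hc x (X'ᘁ ⊗ Y) ▷ X ⊗≫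
        (X'ᘁ : C) ◁ (β_ Y X).hom ⊗≫ (fᘁ ▷ X ≫ ε_ X Xᘁ) ▷ Y ⊗≫ 𝟙 _ := by
      rw [← whisker_exchange]
      monoidal
    _ = 𝟙 _ ⊗≫ c.pt ◁ (X'ᘁ : C) ◁ (β_ Y X).inv ⊗≫ mulAct hc x (X'ᘁ ⊗ Y) ▷ X ⊗≫
        (X'ᘁ : C) ◁ ((β_ Y X).hom ≫ f ▷ Y) ⊗≫ ε_ X' X'ᘁ ▷ Y ⊗≫ 𝟙 _ := by
      rw [rightAdjointMate_comp_evaluation]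
      monoidal
    _ = 𝟙 _ ⊗≫ c.pt ◁ (X'ᘁ : C) ◁ (β_ Y X).inv ⊗≫ (mulAct hc x (X'ᘁ ⊗ Y) ▷ X ≫
        (X'ᘁ ⊗ Y) ◁ f) ⊗≫ (X'ᘁ : C) ◁ (β_ Y X').hom ⊗≫ ε_ X' X'ᘁ ▷ Y ⊗≫ 𝟙 _ := by
      rw [← BraidedCategory.braiding_naturality_right]
      monoidal
    _ = 𝟙 _ ⊗≫ c.pt ◁ (X'ᘁ : C) ◁ ((β_ Y X).inv ≫ Y ◁ f) ⊗≫ mulAct hc x (X'ᘁ ⊗ Y) ▷ X' ⊗≫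
        (X'ᘁ : C) ◁ (β_ Y X').hom ⊗≫ ε_ X' X'ᘁ ▷ Y ⊗≫ 𝟙 _ := by
      rw [← whisker_exchange]
      monoidal
    _ = _ := by
      rw [← BraidedCategory.braiding_inv_naturality_left, mulActEval]
      monoidal

theorem exists_mulActEval_desc (hc : IsCoend c) (x : c.pt ⟶ 𝟙_ C) (Y : C) :
    ∃ Q : c.pt ⊗ (c.pt ⊗ Y) ⟶ Y, ∀ X, c.pt ◁ (incl c X ▷ Y) ≫ Q = mulActEval hc x X Y := by
  -- `descTensor` extends a family only in the leftmost factor, so the two copies of `A` are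
  -- exchanged and the family is precomposed with the inverse exchange.
  refine ⟨(α_ c.pt c.pt Y).inv ≫ (β_ c.pt c.pt).hom ▷ Y ≫ (α_ c.pt c.pt Y).hom ≫
    descTensor hc (fun X => (α_ (Xᘁ ⊗ X) c.pt Y).inv ≫ (β_ c.pt (Xᘁ ⊗ X)).inv ▷ Y ≫
      (α_ c.pt (Xᘁ ⊗ X) Y).hom ≫ mulActEval hc x X Y) ?_, ?_⟩
  · intro X X' f
    have h := mulActEval_dinatural hc x f Y
    have hn : ∀ {D D' : C} (g : D ⟶ D'), g ▷ (c.pt ⊗ Y) ≫ (α_ D' c.pt Y).inv ≫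
        (β_ c.pt D').inv ▷ Y ≫ (α_ c.pt D' Y).hom = (α_ D c.pt Y).inv ≫ (β_ c.pt D).inv ▷ Y ≫
          (α_ c.pt D Y).hom ≫ c.pt ◁ g ▷ Y := by
      intro D D' g
      rw [associator_inv_naturality_left_assoc, ← comp_whiskerRight_assoc,
        BraidedCategory.braiding_inv_naturality_left, comp_whiskerRight_assoc,
        associator_naturality_middle]
    rw [reassoc_of% hn, reassoc_of% hn, h]
  · intro X
    rw [associator_inv_naturality_middle_assoc, ← comp_whiskerRight_assoc,
      BraidedCategory.braiding_naturality_right, comp_whiskerRight_assoc,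
      associator_naturality_left_assoc, incl_descTensor]
    simp

/-- A categorical form of `x(h₁ S(h₂) y) = ε(h) x(y)`, with `X*` playing the role of the antipode.
After `Δ`, `mulAct` becomes `endo x` on `X ⊗ X* ⊗ Y`; naturality along the coevaluation of `X`
reduces it to `endo x Y`, and the remaining cup and cap straighten. -/
theorem comul_mulActEval_desc (hc : IsCoend c) (x : c.pt ⟶ 𝟙_ C) {Y : C}
    {Q : c.pt ⊗ (c.pt ⊗ Y) ⟶ Y} (hQ : ∀ X, c.pt ◁ (incl c X ▷ Y) ≫ Q = mulActEval hc x X Y) :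
    comul hc ▷ Y ≫ (α_ c.pt c.pt Y).hom ≫ Q = counit hc ▷ Y ≫ (λ_ Y).hom ≫ endo x Y := by
  apply tensor_coend_hom_ext hc
  intro X
  calc
    _ = splitDual X ▷ Y ⊗≫ incl c X ▷ ((Xᘁ ⊗ X) ⊗ Y) ≫ c.pt ◁ (incl c X ▷ Y) ≫ Q := by
      rw [← comp_whiskerRight_assoc, incl_comul, MonoidalCategory.tensorHom_def]
      monoidal
    _ = splitDual X ▷ Y ⊗≫ (incl c X ▷ (Xᘁ ⊗ (X ⊗ Y)) ≫ c.pt ◁ (Xᘁ : C) ◁ (β_ Y X).inv) ⊗≫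
        mulAct hc x (Xᘁ ⊗ Y) ▷ X ⊗≫ (Xᘁ : C) ◁ (β_ Y X).hom ⊗≫ ε_ X Xᘁ ▷ Y ⊗≫ 𝟙 _ := by
      rw [hQ, mulActEval]
      monoidal
    _ = splitDual X ▷ Y ⊗≫ (Xᘁ ⊗ X) ◁ (Xᘁ : C) ◁ (β_ Y X).inv ⊗≫
        (incl c X ▷ (Xᘁ ⊗ Y) ≫ mulAct hc x (Xᘁ ⊗ Y)) ▷ X ⊗≫
          (Xᘁ : C) ◁ (β_ Y X).hom ⊗≫ ε_ X Xᘁ ▷ Y ⊗≫ 𝟙 _ := by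
      rw [← whisker_exchange]
      monoidal
    _ = 𝟙 _ ⊗≫ (Xᘁ : C) ◁ (η_ X Xᘁ ▷ (X ⊗ Y) ≫ (X ⊗ Xᘁ) ◁ (β_ Y X).inv) ⊗≫
        (Xᘁ : C) ◁ endo x (X ⊗ (Xᘁ ⊗ Y)) ▷ X ⊗≫ ε_ X Xᘁ ▷ (Xᘁ ⊗ Y ⊗ X) ⊗≫
          (Xᘁ : C) ◁ (β_ Y X).hom ⊗≫ ε_ X Xᘁ ▷ Y ⊗≫ 𝟙 _ := by
      rw [incl_mulAct, splitDual]
      monoidal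
    _ = 𝟙 _ ⊗≫ (Xᘁ : C) ◁ (β_ Y X).inv ⊗≫ (Xᘁ : C) ◁ (((λ_ Y).inv ≫ η_ X Xᘁ ▷ Y ≫
        (α_ X Xᘁ Y).hom) ≫ endo x (X ⊗ (Xᘁ ⊗ Y))) ▷ X ⊗≫ ε_ X Xᘁ ▷ (Xᘁ ⊗ Y ⊗ X) ⊗≫
          (Xᘁ : C) ◁ (β_ Y X).hom ⊗≫ ε_ X Xᘁ ▷ Y ⊗≫ 𝟙 _ := by
      rw [← whisker_exchange]
      monoidal
    _ = 𝟙 _ ⊗≫ (Xᘁ : C) ◁ ((β_ Y X).inv ≫ endo x Y ▷ X) ⊗≫ ((Xᘁ : C) ◁ η_ X Xᘁ ⊗≫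
        ε_ X Xᘁ ▷ (Xᘁ : C)) ▷ (Y ⊗ X) ⊗≫ (Xᘁ : C) ◁ (β_ Y X).hom ⊗≫ ε_ X Xᘁ ▷ Y ⊗≫ 𝟙 _ := by
      rw [endo_naturality]
      monoidal
    _ = 𝟙 _ ⊗≫ (Xᘁ : C) ◁ (X ◁ endo x Y ≫ (β_ Y X).inv ≫ (β_ Y X).hom) ⊗≫
        ε_ X Xᘁ ▷ Y ⊗≫ 𝟙 _ := by
      rw [ExactPairing.coevaluation_evaluation'',
        BraidedCategory.braiding_inv_naturality_right_assoc]
      monoidal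
    _ = 𝟙 _ ⊗≫ (((Xᘁ : C) ⊗ X) ◁ endo x Y ≫ ε_ X Xᘁ ▷ Y) ⊗≫ 𝟙 _ := by
      rw [Iso.inv_hom_id]
      monoidal
    _ = _ := by
      rw [whisker_exchange, ← comp_whiskerRight_assoc, incl_counit]
      monoidal

end ProductAction

/-! ### A cointegral that kills an integral. -/

section Nonvanishing

variable {C : Type*} [Category C] [MonoidalCategory C] [BraidedCategory C] [RightRigidCategory C]

theorem eq_coevaluation_comp_bend {A B : C} [ExactPairing B A] (e : 𝟙_ C ⟶ A ⊗ A) :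
    e = η_ B A ≫
      ((λ_ B).inv ≫ e ▷ B ≫ (α_ A A B).hom ≫ A ◁ ε_ B A ≫ (ρ_ A).hom) ▷ A := by
  symm
  calc
    _ = 𝟙 _ ⊗≫ (𝟙_ C ◁ η_ B A ≫ e ▷ (B ⊗ A)) ⊗≫ A ◁ ε_ B A ▷ A ⊗≫ 𝟙 _ := by monoidal
    _ = e ⊗≫ A ◁ (A ◁ η_ B A ⊗≫ ε_ B A ▷ A) ⊗≫ 𝟙 _ := by
      rw [whisker_exchange]
      monoidal
    _ = _ := by
      rw [ExactPairing.coevaluation_evaluation'']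
      monoidal

variable [Preadditive C] [MonoidalPreadditive C] {c : Cowedge (dualTensor C)}

theorem whiskerRight_comp_mulAct (hc : IsCoend c) {Λ : 𝟙_ C ⟶ c.pt} (hΛ : IsRightIntegral hc Λ)
    {x : c.pt ⟶ 𝟙_ C} (h : Λ ≫ x = 0) (V : C) : Λ ▷ V ≫ mulAct hc x V = 0 := by
  rw [mulAct, ← Category.assoc, whiskerRight_comp_act,
    reassoc_of% (whiskerRight_comp_mul hc hΛ), h, act]
  simp

/-- The integral property gives `x ∘ μ ∘ (Λ ⊗ id) = 0`; colinearity extends this vanishing from `Λ`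
to the first leg of `Δ ∘ Λ`. -/
theorem integral_comp_comul_mulActDual (hc : IsCoend c) {Λ : 𝟙_ C ⟶ c.pt}
    (hΛ : IsRightIntegral hc Λ) {x : c.pt ⟶ 𝟙_ C} (hx : IsCointegral hc x) (h : Λ ≫ x = 0)
    (V : C) : Λ ≫ comul hc ≫ mulActDual hc x V ▷ c.pt = 0 := by
  have h' : Λ ≫ mulActDual hc x V = 0 := by
    rw [mulActDual, rightUnitor_inv_naturality_assoc, ← whisker_exchange_assoc,
      associator_inv_naturality_left_assoc, ← comp_whiskerRight,
      whiskerRight_comp_mulAct hc hΛ h]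
    simp
  rw [comul_mulActDual hc hx, reassoc_of% h', zero_comp]

/-- If a cointegral `x` and an integral `Λ` satisfy `x ∘ Λ = 0`, then also `Λ ∘ x = 0`. -/
theorem cointegral_comp_integral_eq_zero (hc : IsCoend c) {Λ : 𝟙_ C ⟶ c.pt}
    (hΛ : IsRightIntegral hc Λ) {x : c.pt ⟶ 𝟙_ C} (hx : IsCointegral hc x) (h : Λ ≫ x = 0) :
    x ≫ Λ = 0 := by
  -- A dual of `A` on the other side, obtained from `A*` by the braiding; it is used to bend the
  -- second leg of `Δ ∘ Λ`.
  obtain ⟨B, ⟨hB⟩⟩ : ∃ B : C, Nonempty (ExactPairing B c.pt) :=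
    ⟨c.ptᘁ, ⟨BraidedCategory.exactPairing_swap c.pt (c.ptᘁ)⟩⟩
  -- `b` isolates the first leg of `Δ ∘ Λ`, so the vanishing can be used even when further morphisms
  -- act on the second leg.
  obtain ⟨b, hb⟩ : ∃ b : B ⟶ c.pt, b = (λ_ B).inv ≫ (Λ ≫ comul hc) ▷ B ≫
    (α_ c.pt c.pt B).hom ≫ c.pt ◁ ε_ B c.pt ≫ (ρ_ c.pt).hom := ⟨_, rfl⟩
  have he : Λ ≫ comul hc = η_ B c.pt ≫ b ▷ c.pt := by
    rw [hb]
    exact eq_coevaluation_comp_bend _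
  have hbd : ∀ V, b ≫ mulActDual hc x V = 0 := by
    intro V
    calc
      _ = 𝟙 _ ⊗≫ (Λ ≫ comul hc) ▷ B ⊗≫ (c.pt ◁ ε_ B c.pt ≫ mulActDual hc x V ▷ 𝟙_ C) ⊗≫ 𝟙 _ := by
        rw [hb]
        monoidal
      _ = 𝟙 _ ⊗≫ (Λ ≫ comul hc ≫ mulActDual hc x V ▷ c.pt) ▷ B ⊗≫
          (V ⊗ Vᘁ) ◁ ε_ B c.pt ⊗≫ 𝟙 _ := by
        rw [whisker_exchange]
        monoidal
      _ = 0 := by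
        rw [integral_comp_comul_mulActDual hc hΛ hx h]
        simp [monoidalComp]
  have hbm : ∀ V, b ▷ V ≫ mulAct hc x V = 0 := by
    intro V
    rw [mulAct_eq, ← comp_whiskerRight_assoc, hbd]
    simp
  -- In Sweedler notation: `x(y) Λ = x(Λ₁ S(Λ₂) y) Λ₃ = 0`, because every expression `x(Λ₁ · -)`
  -- vanishes.
  have key : ∀ Y, endo x Y ≫ (ρ_ Y).inv ≫ Y ◁ Λ = 0 := by
    intro Y
    obtain ⟨Q, hQ⟩ := exists_mulActEval_desc hc x Y
    have hbQ : b ▷ (c.pt ⊗ Y) ≫ Q = 0 := by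
      rw [← cancel_epi (α_ B c.pt Y).hom]
      apply whiskerLeft_incl_whiskerRight_ext hc
      intro X
      calc
        _ = (α_ B (Xᘁ ⊗ X) Y).hom ≫ (B ◁ (incl c X ▷ Y) ≫ b ▷ (c.pt ⊗ Y)) ≫ Q := by monoidal
        _ = (α_ B (Xᘁ ⊗ X) Y).hom ≫ b ▷ ((Xᘁ ⊗ X) ⊗ Y) ≫ mulActEval hc x X Y := by
          rw [whisker_exchange, Category.assoc, hQ]
        _ = 0 := by
          rw [mulActEval, ← whisker_exchange_assoc, associator_inv_naturality_left_assoc,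
            ← comp_whiskerRight_assoc, hbm]
          simp
        _ = _ := by simp
    -- One morphism computed twice: it is zero because `b` is killed by `Q`, and in `h₂`
    -- coassociativity and the antipode identity reduce it to `endo x Y` alongside `Λ`.
    have h₁ : (Λ ≫ comul hc ≫ c.pt ◁ comul hc) ▷ Y ⊗≫ (c.pt ⊗ c.pt) ◁ (β_ c.pt Y).hom ⊗≫
        Q ▷ c.pt = 0 := by
      calc
        _ = η_ B c.pt ▷ Y ⊗≫ (b ▷ c.pt ≫ c.pt ◁ comul hc) ▷ Y ⊗≫
            (c.pt ⊗ c.pt) ◁ (β_ c.pt Y).hom ⊗≫ Q ▷ c.pt := by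
          rw [reassoc_of% he]
          monoidal
        _ = η_ B c.pt ▷ Y ⊗≫ B ◁ comul hc ▷ Y ⊗≫ (b ▷ (c.pt ⊗ (c.pt ⊗ Y)) ≫
            c.pt ◁ (c.pt ◁ (β_ c.pt Y).hom)) ⊗≫ Q ▷ c.pt := by
          rw [← whisker_exchange]
          monoidal
        _ = η_ B c.pt ▷ Y ⊗≫ B ◁ comul hc ▷ Y ⊗≫ B ◁ c.pt ◁ (β_ c.pt Y).hom ⊗≫
            (b ▷ (c.pt ⊗ Y) ≫ Q) ▷ c.pt := by
          rw [← whisker_exchange]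
          monoidal
        _ = 0 := by
          rw [hbQ]
          simp [monoidalComp]
    have h₂ : (Λ ≫ comul hc ≫ c.pt ◁ comul hc) ▷ Y ⊗≫ (c.pt ⊗ c.pt) ◁ (β_ c.pt Y).hom ⊗≫
        Q ▷ c.pt = Λ ▷ Y ≫ (β_ c.pt Y).hom ≫ endo x Y ▷ c.pt := by
      rw [← comul_coassoc]
      calc
        _ = (Λ ≫ comul hc) ▷ Y ⊗≫ (comul hc ▷ (c.pt ⊗ Y) ≫ (c.pt ⊗ c.pt) ◁ (β_ c.pt Y).hom) ⊗≫
            Q ▷ c.pt := by monoidal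
        _ = (Λ ≫ comul hc) ▷ Y ⊗≫ c.pt ◁ (β_ c.pt Y).hom ⊗≫
            (comul hc ▷ Y ≫ (α_ c.pt c.pt Y).hom ≫ Q) ▷ c.pt := by
          rw [← whisker_exchange]
          monoidal
        _ = (Λ ≫ comul hc) ▷ Y ⊗≫ (c.pt ◁ (β_ c.pt Y).hom ≫ counit hc ▷ (Y ⊗ c.pt)) ⊗≫
            endo x Y ▷ c.pt := by
          rw [comul_mulActEval_desc hc x hQ]
          monoidal
        _ = (Λ ≫ comul hc ≫ counit hc ▷ c.pt) ▷ Y ⊗≫ (β_ c.pt Y).hom ≫ endo x Y ▷ c.pt := by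
          rw [whisker_exchange]
          monoidal
        _ = _ := by
          rw [comul_counit]
          monoidal
    have h₃ := h₂.symm.trans h₁
    rw [BraidedCategory.braiding_naturality_left_assoc, whisker_exchange,
      braiding_tensorUnit_left] at h₃
    calc
      _ = (λ_ Y).inv ≫ ((λ_ Y).hom ≫ (ρ_ Y).inv) ≫ endo x Y ▷ 𝟙_ C ≫ Y ◁ Λ := by
        simp
      _ = 0 := by
        rw [h₃, comp_zero]
  apply coact_ext hc
  intro X
  rw [MonoidalPreadditive.whiskerLeft_zero, comp_zero, ← key X, endo]
  simp

end Nonvanishing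

/-! ### Kernels and finite-dimensional morphism spaces. -/

section FiniteLinear

universe w

variable {k : Type w} [Field k] {C : Type*} [Category C] [Preadditive C] [Linear k C]

theorem IsFiniteLinear.hasKernels (h : IsFiniteLinear k C) : HasKernels C := by
  obtain ⟨A, _, _, _, F, _, _, _⟩ := h
  have : IsNoetherianRing A := IsNoetherianRing.of_finite k A
  have : HasLimitsOfShape WalkingParallelPair C :=
    Adjunction.hasLimitsOfShape_of_equivalence F
  exact ⟨inferInstance⟩

open scoped ModuleCat.Algebra in
theorem IsFiniteLinear.finiteDimensional_hom (h : IsFiniteLinear k C) (X Y : C) :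
    FiniteDimensional k (X ⟶ Y) := by
  obtain ⟨A, _, _, _, F, _, _, _⟩ := h
  let M := F.obj X
  let N := F.obj Y
  let _ : Module k M := inferInstanceAs (Module k M.obj)
  let _ : Module k N := inferInstanceAs (Module k N.obj)
  have : IsScalarTower k A M := inferInstanceAs (IsScalarTower k A M.obj)
  have : IsScalarTower k A N := inferInstanceAs (IsScalarTower k A N.obj)
  have : Module.Finite k M := Module.Finite.trans A M
  have : Module.Finite k N := Module.Finite.trans A N
  let φ : (X ⟶ Y) →ₗ[k] (M →ₗ[k] N) :=
    { toFun f := (F.map f).hom.hom.restrictScalars k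
      map_add' f g := by
        rw [F.map_add]
        rfl
      map_smul' r f := by
        rw [F.map_smul]
        rfl }
  refine FiniteDimensional.of_injective φ fun f g hfg => F.map_injective ?_
  ext x
  exact LinearMap.congr_fun hfg x

end FiniteLinear

/-! ### Scalars in a modular category: existence of `ζ` and the product formula. -/

section Modular

universe w

variable {k : Type w} [Field k] {C : Type*} [Category C] [Preadditive C] [Linear k C]
  [MonoidalCategory C] [MonoidalPreadditive C] [MonoidalLinear k C]
  [BraidedCategory C] [RightRigidCategory C] {c : Cowedge (dualTensor C)} (hc : IsCoend c)

theorem IsCointegral.smul {hc : IsCoend c} {x : c.pt ⟶ 𝟙_ C} (hx : IsCointegral hc x) (r : k) :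
    IsCointegral hc (r • x) where
  right := by simp [MonoidalLinear.smul_whiskerRight, hx.right]
  left := by simp [MonoidalLinear.whiskerLeft_smul, hx.left]

theorem pairingLeft_ne_zero (hω : IsNondegenerate (hopfPairing hc)) {Λ : 𝟙_ C ⟶ c.pt}
    (hΛ : Λ ≠ 0) : pairingLeft hc Λ ≠ 0 := by
  intro h
  rw [pairingLeft, Iso.inv_comp_eq, comp_zero] at h
  have h' : Λ ≫ (λ_ c.pt).inv = 0 := by
    apply hω.ext_left
    calc
      _ = (Λ ▷ c.pt ≫ hopfPairing hc) ≫ (λ_ (𝟙_ C)).inv := by simp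
      _ = _ := by simp [h]
  exact hΛ (zero_of_comp_mono _ h')

variable [IsAlgClosed k] [RibbonCategory C]

/-- Schur's lemma over an algebraically closed field, for the simple unit object. -/
theorem IsModular.exists_smul_id_eq (hC : IsModular k C) (f : 𝟙_ C ⟶ 𝟙_ C) :
    ∃ r : k, f = r • 𝟙 (𝟙_ C) := by
  have := hC.simple_unit
  have := hC.finite.hasKernels
  have := hC.finite.finiteDimensional_hom (𝟙_ C) (𝟙_ C)
  obtain ⟨r, hr⟩ := endomorphism_simple_eq_smul_id k f
  exact ⟨r, hr.symm⟩

theorem IsModular.exists_isModularityParameter (hC : IsModular k C) {Λ : 𝟙_ C ⟶ c.pt}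
    (hΛ : IsRightIntegral hc Λ) (h₀ : Λ ≠ 0) : ∃ ζ : k, IsModularityParameter k hc Λ ζ := by
  have := hC.simple_unit
  have := hC.finite.hasKernels
  have hω := hC.factorizable c hc
  have hx := isCointegral_pairingLeft hc hω hΛ
  obtain ⟨ζ, hζ⟩ := hC.exists_smul_id_eq (Λ ≫ pairingLeft hc Λ)
  have hζ₀ : ζ ≠ 0 := by
    -- If `x ∘ Λ = 0` for `x = pairingLeft hc Λ`, then `Λ ∘ x = 0`. A nonzero morphism out of a
    -- simple object is a monomorphism, so `x = 0`, against non-degeneracy.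
    rintro rfl
    rw [zero_smul] at hζ
    have := mono_of_nonzero_from_simple h₀
    exact pairingLeft_ne_zero hc hω h₀
      (zero_of_comp_mono Λ (cointegral_comp_integral_eq_zero hc hΛ hx hζ))
  refine ⟨ζ, hζ₀, ζ⁻¹ • pairingLeft hc Λ, hx.smul _, ?_, ?_⟩
  · rw [Linear.comp_smul, hζ, inv_smul_smul₀ hζ₀]
  · rw [smul_inv_smul₀ hζ₀, pairingLeft]

theorem IsModular.mul_eq_of_isModularityParameter (hC : IsModular k C) {Λ : 𝟙_ C ⟶ c.pt}
    (hΛ : IsRightIntegral hc Λ) {dm dp ζ : k} (hm : IsStabilizationCoeffMinus k hc Λ dm)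
    (hp : IsStabilizationCoeffPlus k hc Λ dp) (hζ : IsModularityParameter k hc Λ ζ) :
    dm * dp = ζ := by
  have := hC.simple_unit
  obtain ⟨-, x, -, hx, h⟩ := hζ
  have key := comp_pairingLeft_self hc hΛ
    (isCointegral_pairingRight hc (hC.factorizable c hc) hΛ)
  rw [IsStabilizationCoeffMinus] at hm
  rw [IsStabilizationCoeffPlus] at hp
  rw [hm, hp, pairingLeft, h, Linear.comp_smul, hx, Linear.smul_comp, Category.id_comp,
    smul_smul] at key
  rw [mul_comm]
  exact (smul_left_injective k (id_nonzero (𝟙_ C)) key).symm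

end Modular

end RibbonCategory

theorem corollaryC {k : Type*} [Field k] [IsAlgClosed k]
    {C : Type*} [Category C] [Preadditive C] [Linear k C]
    [MonoidalCategory C] [MonoidalPreadditive C] [MonoidalLinear k C]
    [BraidedCategory C] [RightRigidCategory C] [RibbonCategory C]
    (hC : RibbonCategory.IsModular k C) :
    (∀ (c : Cowedge (RibbonCategory.dualTensor C)) (hc : RibbonCategory.IsCoend c)
      (Λ : 𝟙_ C ⟶ c.pt), RibbonCategory.IsRightIntegral hc Λ → Λ ≠ 0 →
      (∃ dm dp ζ : k, RibbonCategory.IsStabilizationCoeffMinus k hc Λ dm ∧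
        RibbonCategory.IsStabilizationCoeffPlus k hc Λ dp ∧
        RibbonCategory.IsModularityParameter k hc Λ ζ) ∧
      ∀ dm dp ζ : k, RibbonCategory.IsStabilizationCoeffMinus k hc Λ dm →
        RibbonCategory.IsStabilizationCoeffPlus k hc Λ dp →
        RibbonCategory.IsModularityParameter k hc Λ ζ → dm * dp = ζ) ∧
    RibbonCategory.IsTwistNondegenerate k C := by
  have key : ∀ (c : Cowedge (RibbonCategory.dualTensor C)) (hc : RibbonCategory.IsCoend c)
      (Λ : 𝟙_ C ⟶ c.pt), RibbonCategory.IsRightIntegral hc Λ → Λ ≠ 0 →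
      ∃ dm dp ζ : k, RibbonCategory.IsStabilizationCoeffMinus k hc Λ dm ∧
        RibbonCategory.IsStabilizationCoeffPlus k hc Λ dp ∧
        RibbonCategory.IsModularityParameter k hc Λ ζ := by
    intro c hc Λ hΛ h₀
    obtain ⟨dm, hm⟩ := hC.exists_smul_id_eq
      (Λ ≫ (RibbonCategory.tTransformation hc).inv ≫ RibbonCategory.counit hc)
    obtain ⟨dp, hp⟩ := hC.exists_smul_id_eq
      (Λ ≫ (RibbonCategory.tTransformation hc).hom ≫ RibbonCategory.counit hc)
    obtain ⟨ζ, hζ⟩ := hC.exists_isModularityParameter hc hΛ h₀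
    exact ⟨dm, dp, ζ, hm, hp, hζ⟩
  refine ⟨fun c hc Λ hΛ h₀ => ⟨key c hc Λ hΛ h₀, fun dm dp ζ hm hp hζ =>
    hC.mul_eq_of_isModularityParameter hc hΛ hm hp hζ⟩, fun c hc Λ hΛ h₀ => ?_⟩
  obtain ⟨dm, dp, ζ, hm, hp, hζ⟩ := key c hc Λ hΛ h₀
  -- The product is the modularity parameter, which is nonzero, so neither factor vanishes.
  have h : dm * dp ≠ 0 := by
    rw [hC.mul_eq_of_isModularityParameter hc hΛ hm hp hζ]
    exact hζ.1
  exact ⟨dp, dm, right_ne_zero_of_mul h, left_ne_zero_of_mul h, hp, hm⟩
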